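/- Let $n\ge 2$ and let $\Omega\subset\mathbb{R}^n_x\times\mathbb{R}_t$ be a bounded open set. There exist $v\in L^\infty(\mathbb{R}^n_x\times\mathbb{R}_t;\mathbb{R}^n)$ and $p\in L^\infty(\mathbb{R}^n_x\times\mathbb{R}_t)$ which solve the Euler equations $$\partial_t v+\operatorname{div}(v\otimes v)+\nabla p=0,\qquad \operatorname{div}v=0$$ in the sense of distributions on $\mathbb{R}^n_x\times\mathbb{R}_t$ and satisfy - $|v(x,t)|=1$ for a.e. $(x,t)\in\Omega$, - $v(x,t)=0$ and $p(x,t)=0$ for a.e. $(x,t)\in(\mathbb{R}^n_x\times\mathbb{R}_t)\setminus\Omega$. Moreover, there exist sequences $v_k,f_k\in C_c^\infty(\Omega;\mathbb{R}^n)$ and $p_k\in C_c^\infty(\Omega)$ such that for every $k$ $$\partial_t v_k+\operatorname{div}(v_k\otimes v_k)+\nabla p_k=f_k,\qquad \operatorname{div}v_k=0,$$ and - $f_k\to0$ in $H^{-1}(\mathbb{R}^n_x\times\mathbb{R}_t;\mathbb{R}^n)$, the dual of $H^1(\mathbb{R}^n_x\times\mathbb{R}_t;\mathbb{R}^n)$,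 - $\sup_k\left(\|v_k\|_{L^\infty}+\|p_k\|_{L^\infty}\right)<\infty$, - $v_k\to v$ and $p_k\to p$ in $L^q(\mathbb{R}^n_x\times\mathbb{R}_t)$ for every $0<q<\infty$. -/

import Mathlib

open MeasureTheory Filter Topology
open scoped ENNReal NNReal Distributions

noncomputable section

namespace Euler

/-- Velocity (and position) space `ℝⁿ` with the Euclidean norm. -/
abbrev Space (n : ℕ) : Type := EuclideanSpace ℝ (Fin n)

/-- Space-time `ℝⁿₓ × ℝₜ`, with Lebesgue measure `volume`. -/
abbrev SpaceTime (n : ℕ) : Type := Space n × ℝ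

/-- The partial derivative `∂g/∂x_j`. -/
def dx {n : ℕ} {F : Type*} [NormedAddCommGroup F] [NormedSpace ℝ F]
    (j : Fin n) (g : SpaceTime n → F) (z : SpaceTime n) : F :=
  fderiv ℝ g z (EuclideanSpace.single j 1, 0)

/-- The time derivative `∂g/∂t`. -/
def dt {n : ℕ} {F : Type*} [NormedAddCommGroup F] [NormedSpace ℝ F]
    (g : SpaceTime n → F) (z : SpaceTime n) : F :=
  fderiv ℝ g z (0, 1)

/-- The divergence in the space variables, `∑ⱼ ∂ⱼ wⱼ`. -/
def divx {n : ℕ} (w : SpaceTime n → Space n) (z : SpaceTime n) : ℝ :=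
  ∑ j, dx j (fun y => w y j) z

/-- Classical solutions of `∂ₜv + div (v ⊗ v) + ∇p = f`, `div v = 0`
(used for smooth `v`, `p` only). -/
structure IsClassicalSolution {n : ℕ} (v : SpaceTime n → Space n) (p : SpaceTime n → ℝ)
    (f : SpaceTime n → Space n) : Prop where
  momentum : ∀ z, ∀ i : Fin n,
    dt (fun y => v y i) z + ∑ j, dx j (fun y => v y i * v y j) z + dx i p z = f z i
  incompressible : ∀ z, divx v z = 0

/-- Weak solutions: `∂ₜv + div (v ⊗ v) + ∇p = f`, `div v = 0` in the sense of distributions on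
`ℝⁿₓ × ℝₜ`, with `v ∈ L²_loc` and `p, f ∈ L¹_loc`. -/
structure IsWeakSolution {n : ℕ} (v : SpaceTime n → Space n) (p : SpaceTime n → ℝ)
    (f : SpaceTime n → Space n) : Prop where
  aestronglyMeasurable : AEStronglyMeasurable v volume
  sq_locallyIntegrable : LocallyIntegrable (fun z => ‖v z‖ ^ 2) volume
  pressure_locallyIntegrable : LocallyIntegrable p volume
  force_locallyIntegrable : LocallyIntegrable f volume
  momentum : ∀ φ : 𝓓((⊤ : TopologicalSpace.Opens (SpaceTime n)), Space n),
    ∫ z, ((∑ i, v z i * dt (fun y => φ y i) z)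
      + (∑ i, ∑ j, v z i * v z j * dx j (fun y => φ y i) z)
      + p z * divx φ z
      + ∑ i, f z i * φ z i) = 0
  incompressible : ∀ ψ : 𝓓((⊤ : TopologicalSpace.Opens (SpaceTime n)), ℝ),
    ∫ z, ∑ j, v z j * dx j ψ z = 0

/-- The squared `H¹(ℝⁿₓ × ℝₜ; ℝⁿ)` norm of a test function, all `n + 1` first derivatives being
taken into account. -/
def h1NormSq {n : ℕ} (φ : 𝓓((⊤ : TopologicalSpace.Opens (SpaceTime n)), Space n)) : ℝ :=
  ∫ z, (‖φ z‖ ^ 2 + ‖dt φ z‖ ^ 2 + ∑ j, ‖dx j φ z‖ ^ 2)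

/-- The norm of `f` in `H⁻¹(ℝⁿₓ × ℝₜ; ℝⁿ)`, the dual of `H¹`. Since test functions are dense in
`H¹`, the supremum may be taken over test functions. -/
def hNegOneNorm {n : ℕ} (f : SpaceTime n → Space n) : ℝ≥0∞ :=
  ⨆ φ : 𝓓((⊤ : TopologicalSpace.Opens (SpaceTime n)), Space n), ⨆ _ : h1NormSq φ ≤ 1,
    ENNReal.ofReal |∫ z, ∑ i, f z i * φ z i|

end Euler

end

/-!
The velocities are obtained by convex integration. A *subsolution* solves the linear system
`∂ₜv + div u = 0`, `div v = 0` and takes its values in the open set where the stress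
`I / n + u - v ⊗ v` is positive definite. The trace of the stress is the defect `1 - |v|²`, so at
each point some unit vector `e` is an eigenvector for an eigenvalue at least `(1 - |v|²) / n`; the
state can then be moved by a multiple of `(e, e ⊗ y + y ⊗ e)`, `e ⊥ y`, of length comparable to the
defect, and this is a direction of plane waves. Localized waves of high frequency raise the energy
`∫ |v|²` by a fixed fraction of `∫ (1 - |v|²)²` and are almost orthogonal to all the previous
velocities. As the energy is bounded, the velocities converge in `L²` and the defect tends to zero.

The entries of a positive semidefinite matrix are bounded by its trace, so with the pressure
`-|v|² / n` the flux error of a subsolution is controlled by its defect. This gives the convergence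
of the forces in `H⁻¹` and, in the limit, the Euler equations.
-/

noncomputable section

open LineDeriv
open scoped ContDiff Matrix RealInnerProductSpace

namespace Euler

section TestFunctionCalculus

variable {E F F' : Type*} [NormedAddCommGroup E] [NormedSpace ℝ E] [NormedAddCommGroup F]
  [NormedSpace ℝ F] [NormedAddCommGroup F'] [NormedSpace ℝ F'] {Ω Ω' : TopologicalSpace.Opens E}

theorem eq_zero_of_notMem (f : 𝓓(Ω, F)) {x : E} (hx : x ∉ Ω) : f x = 0 :=
  image_eq_zero_of_notMem_tsupport fun h => hx (f.tsupport_subset h)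

theorem lineDerivOp_apply (f : 𝓓(Ω, F)) (w x : E) : (∂_{w} f) x = fderiv ℝ f x w := by
  rw [TestFunction.lineDerivOp_eq_lineDerivCLM ℝ, TestFunction.lineDerivCLM_eq_fderivCLM,
    TestFunction.fderivCLM_apply_of_le f le_top]

theorem lineDerivOp_comm (f : 𝓓(Ω, F)) (w w' : E) : ∂_{w} (∂_{w'} f) = ∂_{w'} (∂_{w} f) := by
  have hdiff : Differentiable ℝ (fderiv ℝ f) :=
    (f.contDiff.fderiv_right (m := 1) (by norm_num [ENat.LEInfty.out])).differentiable one_ne_zero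
  have hderiv (a b x : E) : (∂_{a} (∂_{b} f)) x = fderiv ℝ (fderiv ℝ f) x a b := by
    have hcoe : ((∂_{b} f : 𝓓(Ω, F)) : E → F) = fun y => fderiv ℝ f y b :=
      funext (lineDerivOp_apply f b)
    rw [lineDerivOp_apply, hcoe, fderiv_clm_apply (hdiff x) (differentiableAt_const b)]
    simp
  ext x
  rw [hderiv, hderiv]
  exact f.contDiff.contDiffAt.isSymmSndFDerivAt (by simp [ENat.LEInfty.out]) w w'

theorem lineDerivOp_postcompCLM (T : F →L[ℝ] F') (f : 𝓓(Ω, F)) (w : E) :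
    ∂_{w} (TestFunction.postcompCLM T f) = TestFunction.postcompCLM T (∂_{w} f) := by
  ext x
  have hf : DifferentiableAt ℝ f x := (f.contDiff.differentiable (by simp)).differentiableAt
  rw [lineDerivOp_apply, TestFunction.postcompCLM_apply, TestFunction.postcompCLM_apply,
    fderiv_comp x T.differentiableAt hf, T.fderiv, Function.comp_apply, lineDerivOp_apply]
  rfl

/-- Composition of a test function with a smooth, possibly nonlinear, map that fixes the
origin. -/
def smoothComp (g : F → F') (hg : ContDiff ℝ ∞ g) (h₀ : g 0 = 0) (f : 𝓓(Ω, F)) : 𝓓(Ω, F') where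
  toFun := g ∘ f
  contDiff' := hg.comp f.contDiff
  hasCompactSupport' := f.hasCompactSupport.comp_left h₀
  tsupport_subset' := (tsupport_comp_subset h₀ f).trans f.tsupport_subset

/-- Product of a test function with a smooth function. -/
def smoothMul (g : E → ℝ) (hg : ContDiff ℝ ∞ g) (χ : 𝓓(Ω, ℝ)) : 𝓓(Ω, ℝ) where
  toFun x := g x * χ x
  contDiff' := hg.mul χ.contDiff
  hasCompactSupport' := χ.hasCompactSupport.mul_left
  tsupport_subset' := (tsupport_mul_subset_right (f := g)).trans χ.tsupport_subset

/-- The test function with values on the line spanned by `P` and scalar factor `g`. -/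
def smulConst (P : F) (g : 𝓓(Ω, ℝ)) : 𝓓(Ω, F) :=
  TestFunction.postcompCLM (ContinuousLinearMap.toSpanSingleton ℝ P) g

theorem smulConst_apply (P : F) (g : 𝓓(Ω, ℝ)) (x : E) : smulConst P g x = g x • P := rfl

section Integrability

variable [MeasurableSpace E] [OpensMeasurableSpace E] {μ : Measure E}
  [IsFiniteMeasureOnCompacts μ]

theorem integrable_comp {W : Type*} [NormedAddCommGroup W] (f : 𝓓(Ω, F)) {g : F → W}
    (hg : Continuous g) (h₀ : g 0 = 0) : Integrable (fun x => g (f x)) μ :=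
  (hg.comp f.continuous).integrable_of_hasCompactSupport (f.hasCompactSupport.comp_left h₀)

theorem integrable_inner {V : Type*} [NormedAddCommGroup V] [InnerProductSpace ℝ V]
    (f : 𝓓(Ω, V)) (g : 𝓓(Ω', V)) : Integrable (fun x => ⟪f x, g x⟫) μ :=
  (f.continuous.inner g.continuous).integrable_of_hasCompactSupport
    (f.hasCompactSupport.mono fun x hx h₀ => hx (by simp only [h₀, inner_zero_left]))

theorem integrable_norm_sq (f : 𝓓(Ω, F)) : Integrable (fun x => ‖f x‖ ^ 2) μ :=
  integrable_comp f (g := (‖·‖ ^ 2)) (by fun_prop) (by simp)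

end Integrability

variable [FiniteDimensional ℝ E] [MeasurableSpace E] [BorelSpace E] (μ : Measure E)
  [μ.IsAddHaarMeasure]

theorem integral_inner_lineDerivOp {V : Type*} [NormedAddCommGroup V] [InnerProductSpace ℝ V]
    (f : 𝓓(Ω, V)) (g : 𝓓(Ω', V)) (w : E) :
    ∫ x, ⟪f x, (∂_{w} g) x⟫ ∂μ = -∫ x, ⟪(∂_{w} f) x, g x⟫ ∂μ := by
  have hderiv {Ω : TopologicalSpace.Opens E} (f : 𝓓(Ω, V)) (x : E) :
      HasLineDerivAt ℝ f ((∂_{w} f) x) x w := by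
    rw [lineDerivOp_apply]
    exact (f.contDiff.differentiable (by simp) x).hasFDerivAt.hasLineDerivAt w
  exact integral_bilinear_hasLineDerivAt_right_eq_neg_left_of_integrable (B := innerSL ℝ)
    (integrable_inner (∂_{w} f) g) (integrable_inner f (∂_{w} g)) (integrable_inner f g)
    (fun x _ => hderiv f x) fun x _ => hderiv g x

end TestFunctionCalculus

section SpaceTimeDivergence

variable {n : ℕ} {Ω Ω' : TopologicalSpace.Opens (SpaceTime n)}

instance isAddHaarMeasure_volume : (volume : Measure (SpaceTime n)).IsAddHaarMeasure :=
  inferInstanceAs ((volume : Measure (Space n)).prod (volume : Measure ℝ)).IsAddHaarMeasure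

/-- The `j`-th coordinate vector of `ℝⁿ`, as a direction in space-time. -/
def spaceDir (j : Fin n) : SpaceTime n := (EuclideanSpace.single j 1, 0)

/-- The spatial coordinate `(x, t) ↦ x j`. -/
def spaceCoord (j : Fin n) : SpaceTime n →L[ℝ] ℝ :=
  EuclideanSpace.proj j ∘L ContinuousLinearMap.fst ℝ (Space n) ℝ

/-- The space-time divergence `∑ⱼ ∂ⱼ Xⱼ + ∂ₜ Xₜ` of a vector field `X` on `ℝⁿₓ × ℝₜ`. -/
def stDiv : 𝓓(Ω, SpaceTime n) →ₗ[ℝ] 𝓓(Ω, ℝ) :=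
  ∑ j, (lineDerivOpCLM ℝ 𝓓(Ω, ℝ) (spaceDir j) ∘L
        TestFunction.postcompCLM (spaceCoord j)).toLinearMap
    + (lineDerivOpCLM ℝ 𝓓(Ω, ℝ) ((0, 1) : SpaceTime n) ∘L
        TestFunction.postcompCLM (ContinuousLinearMap.snd ℝ (Space n) ℝ)).toLinearMap

theorem sum_smul_spaceDir_add (X : SpaceTime n) :
    ∑ j, X.1 j • spaceDir j + X.2 • (0, 1) = X := by
  ext i
  · simp [spaceDir, Prod.fst_sum, Pi.single_apply]
  · simp [spaceDir, Prod.snd_sum]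

theorem fderiv_apply_eq_sum_dx_add_dt {F : Type*} [NormedAddCommGroup F] [NormedSpace ℝ F]
    (g : SpaceTime n → F) (z X : SpaceTime n) :
    fderiv ℝ g z X = ∑ j, X.1 j • dx j g z + X.2 • dt g z := by
  conv_lhs => rw [← sum_smul_spaceDir_add X]
  simp only [map_add, map_sum, map_smul]
  rfl

theorem stDiv_eq (X : 𝓓(Ω, SpaceTime n)) :
    stDiv X = ∑ j, ∂_{spaceDir j} (TestFunction.postcompCLM (spaceCoord j) X)
      + ∂_{((0, 1) : SpaceTime n)}
          (TestFunction.postcompCLM (ContinuousLinearMap.snd ℝ (Space n) ℝ) X) := by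
  simp [stDiv]

theorem stDiv_apply (X : 𝓓(Ω, SpaceTime n)) (z : SpaceTime n) :
    stDiv X z = ∑ j, dx j (fun y => (X y).1 j) z + dt (fun y => (X y).2) z := by
  simp only [stDiv_eq, FunLike.coe_add, FunLike.coe_sum, Pi.add_apply, Finset.sum_apply,
    lineDerivOp_apply]
  rfl

theorem stDiv_smulConst (X : SpaceTime n) (g : 𝓓(Ω, ℝ)) : stDiv (smulConst X g) = ∂_{X} g := by
  have hcoord (T : SpaceTime n →L[ℝ] ℝ) :
      TestFunction.postcompCLM T (smulConst X g) = T X • g := by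
    ext z
    simp [smulConst, mul_comm]
  rw [stDiv_eq]
  simp only [hcoord, lineDerivOp_smul, ← lineDerivOp_left_smul, ← lineDerivOp_left_sum,
    ← lineDerivOp_left_add]
  exact congrArg (fun w => ∂_{w} g) (sum_smul_spaceDir_add X)

theorem integral_fderiv_eq_neg_integral_mul_stDiv (ψ : 𝓓(Ω', ℝ)) (X : 𝓓(Ω, SpaceTime n)) :
    ∫ z, fderiv ℝ ψ z (X z) = -∫ z, ψ z * stDiv X z := by
  have hint {Ω Ω' : TopologicalSpace.Opens (SpaceTime n)} (f : 𝓓(Ω, ℝ)) (g : 𝓓(Ω', ℝ)) :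
      Integrable fun z => f z * g z := integrable_inner g f
  have hparts (f : 𝓓(Ω, ℝ)) (w : SpaceTime n) :
      ∫ z, f z * (∂_{w} ψ) z = -∫ z, ψ z * (∂_{w} f) z := by
    simpa [mul_comm] using integral_inner_lineDerivOp volume f ψ w
  have hfderiv (z : SpaceTime n) : fderiv ℝ ψ z (X z) =
      ∑ j, TestFunction.postcompCLM (spaceCoord j) X z * (∂_{spaceDir j} ψ) z
        + TestFunction.postcompCLM (ContinuousLinearMap.snd ℝ (Space n) ℝ) X z
          * (∂_{((0, 1) : SpaceTime n)} ψ) z := by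
    simp only [lineDerivOp_apply]
    exact fderiv_apply_eq_sum_dx_add_dt ψ z (X z)
  simp only [hfderiv, stDiv_eq, FunLike.coe_add, FunLike.coe_sum, Pi.add_apply, Finset.sum_apply,
    mul_add, Finset.mul_sum]
  rw [integral_add (integrable_finsetSum _ fun j _ => hint _ _) (hint _ _),
    integral_add (integrable_finsetSum _ fun j _ => hint _ _) (hint _ _),
    integral_finsetSum _ fun j _ => hint _ _, integral_finsetSum _ fun j _ => hint _ _]
  simp only [hparts, Finset.sum_neg_distrib, neg_add]

end SpaceTimeDivergence

section PositiveMatrices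

variable {ι : Type*}

theorem posDef_sub_smul_of_lt {A B : Matrix ι ι ℝ} {s t : ℝ} (hA : A.PosDef) (hB : B.PosSemidef)
    (hAB : (A - t • B).PosSemidef) (hst : s < t) (ht : 0 < t) : (A - s • B).PosDef := by
  rcases le_or_gt s 0 with hs | hs
  · rw [sub_eq_add_neg, ← neg_smul]
    exact hA.add_posSemidef (hB.smul (neg_nonneg.2 hs))
  · have hsplit : A - s • B = (1 - s / t) • A + (s / t) • (A - t • B) := by
      rw [smul_sub, smul_smul, div_mul_cancel₀ s ht.ne']
      module
    rw [hsplit]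
    exact (hA.smul (sub_pos.2 ((div_lt_one ht).2 hst))).add_posSemidef (hAB.smul (by positivity))

theorem posSemidef_vecMulVec_self [Finite ι] (e : ι → ℝ) : (Matrix.vecMulVec e e).PosSemidef := by
  simpa using Matrix.posSemidef_vecMulVec_self_star e

variable [Fintype ι]

theorem isOpen_setOf_forall_dotProduct_mulVec_pos :
    IsOpen {A : Matrix ι ι ℝ | ∀ x : ι → ℝ, x ≠ 0 → 0 < x ⬝ᵥ A *ᵥ x} := by
  have hsphere : {A : Matrix ι ι ℝ | ∀ x : ι → ℝ, x ≠ 0 → 0 < x ⬝ᵥ A *ᵥ x} =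
      {A | ∀ x ∈ Metric.sphere (0 : ι → ℝ) 1, 0 < x ⬝ᵥ A *ᵥ x} := by
    ext A
    refine ⟨fun h x hx => h x (ne_zero_of_mem_unit_sphere ⟨x, hx⟩), fun h x hx => ?_⟩
    have hunit := h (‖x‖⁻¹ • x) (by simp [norm_smul, hx])
    rw [Matrix.mulVec_smul, smul_dotProduct, dotProduct_smul, smul_smul] at hunit
    exact (pos_iff_pos_of_mul_pos hunit).1 (by positivity)
  rw [hsphere, isOpen_iff_eventually]
  intro A hA
  refine (isCompact_sphere _ _).eventually_forall_of_forall_eventually fun x hx => ?_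
  have hcont : Continuous fun q : Matrix ι ι ℝ × (ι → ℝ) => q.2 ⬝ᵥ q.1 *ᵥ q.2 := by fun_prop
  exact hcont.continuousAt.eventually (lt_mem_nhds (hA x hx))

theorem abs_apply_le_trace {A : Matrix ι ι ℝ} (hA : A.PosSemidef) (i j : ι) :
    |A i j| ≤ A.trace := by
  classical
  have hdiag (k : ι) : A k k ≤ A.trace :=
    Finset.single_le_sum (f := fun k => A k k) (fun k _ => hA.diag_nonneg) (Finset.mem_univ k)
  have hsymm : A j i = A i j := hA.isHermitian.apply i j
  have hadd := hA.dotProduct_mulVec_nonneg (Pi.single i 1 + Pi.single j 1)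
  have hsub := hA.dotProduct_mulVec_nonneg (Pi.single i 1 - Pi.single j 1)
  simp only [star_trivial, Matrix.mulVec_add, Matrix.mulVec_sub, Matrix.mulVec_single,
    MulOpposite.op_one, one_smul, dotProduct_add, add_dotProduct, dotProduct_sub, sub_dotProduct,
    single_dotProduct, Matrix.col_apply, one_mul, hsymm] at hadd hsub
  rw [abs_le]
  constructor <;> linarith [hdiag i, hdiag j]

theorem dotProduct_mulVec_eq_sum_eigenvalues [DecidableEq ι] {A : Matrix ι ι ℝ}
    (hA : A.IsHermitian) (x : ι → ℝ) :
    x ⬝ᵥ A *ᵥ x = ∑ i, hA.eigenvalues i * (x ⬝ᵥ hA.eigenvectorBasis i) ^ 2 := by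
  have hx : x = ∑ i, (x ⬝ᵥ hA.eigenvectorBasis i) • (hA.eigenvectorBasis i : ι → ℝ) := by
    have h := congrArg WithLp.ofLp (hA.eigenvectorBasis.sum_repr' (WithLp.toLp 2 x))
    simpa [PiLp.inner_apply, dotProduct, mul_comm] using h.symm
  conv_lhs => enter [2, 2]; rw [hx]
  simp only [Matrix.mulVec_sum, Matrix.mulVec_smul, hA.mulVec_eigenvectorBasis, dotProduct_sum,
    dotProduct_smul, smul_eq_mul]
  exact Finset.sum_congr rfl fun i _ => by ring

theorem exists_posSemidef_sub_smul_vecMulVec [Nonempty ι] {A : Matrix ι ι ℝ}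
    (hA : A.PosSemidef) :
    ∃ e : EuclideanSpace ℝ ι, ‖e‖ = 1 ∧
      (A - (A.trace / Fintype.card ι) • Matrix.vecMulVec e e).PosSemidef := by
  classical
  have hH := hA.isHermitian
  obtain ⟨m, -, hm⟩ : ∃ m ∈ Finset.univ, A.trace / Fintype.card ι ≤ hH.eigenvalues m := by
    refine Finset.exists_le_of_sum_le Finset.univ_nonempty (le_of_eq ?_)
    simp [hH.trace_eq_sum_eigenvalues, mul_div_cancel₀]
  refine ⟨hH.eigenvectorBasis m, hH.eigenvectorBasis.norm_eq_one m, .of_dotProduct_mulVec_nonneg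
    (hH.sub ((posSemidef_vecMulVec_self _).isHermitian.smul (IsSelfAdjoint.all _))) fun x => ?_⟩
  have hle : A.trace / Fintype.card ι * (x ⬝ᵥ hH.eigenvectorBasis m) ^ 2 ≤ x ⬝ᵥ A *ᵥ x := by
    rw [dotProduct_mulVec_eq_sum_eigenvalues hH]
    refine (mul_le_mul_of_nonneg_right hm (sq_nonneg _)).trans ?_
    exact Finset.single_le_sum (f := fun i => hH.eigenvalues i * (x ⬝ᵥ hH.eigenvectorBasis i) ^ 2)
      (fun i _ => mul_nonneg (hA.eigenvalues_nonneg i) (sq_nonneg _)) (Finset.mem_univ m)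
  simp only [star_trivial, Matrix.sub_mulVec, Matrix.smul_mulVec, Matrix.vecMulVec_mulVec,
    op_smul_eq_smul, dotProduct_sub, dotProduct_smul, smul_eq_mul, sub_nonneg]
  rwa [dotProduct_comm _ x, ← sq]

end PositiveMatrices

section States

variable {n : ℕ}

/-- The symmetric trace-free `n × n` matrices, in which the flux of the linear system
`∂ₜv + div u = 0`, `div v = 0` takes its values. -/
def tracelessSymm (n : ℕ) : Submodule ℝ (Fin n → Fin n → ℝ) where
  carrier := {u | (∀ i j, u i j = u j i) ∧ ∑ i, u i i = 0}
  add_mem' := fun ⟨hu, hu'⟩ ⟨hw, hw'⟩ =>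
    ⟨fun i j => congrArg₂ (· + ·) (hu i j) (hw i j), by
      simp only [Pi.add_apply, Finset.sum_add_distrib, hu', hw', add_zero]⟩
  zero_mem' := by simp
  smul_mem' c u := fun ⟨hu, hu'⟩ =>
    ⟨fun i j => congrArg (c * ·) (hu i j), by
      simp only [Pi.smul_apply, ← Finset.smul_sum, hu', smul_zero]⟩

/-- The pairs `(v, u)` of a velocity and a trace-free flux. -/
abbrev State (n : ℕ) : Type := Space n × tracelessSymm n

/-- The trace-free part of the symmetric product `p ⊗ q + q ⊗ p`. -/
def symProd (p q : Space n) : tracelessSymm n :=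
  ⟨fun i j => p i * q j + q i * p j - if i = j then 2 * ⟪p, q⟫ / n else 0, fun i j => by
    simp only [eq_comm]; ring, by
    rcases eq_or_ne (n : ℝ) 0 with hn | hn
    · rw [Nat.cast_eq_zero] at hn
      subst hn
      rfl
    · simp [PiLp.inner_apply, Finset.sum_add_distrib, mul_comm, mul_div_cancel₀ _ hn, two_mul]⟩

theorem symProd_apply {p q : Space n} (h : ⟪p, q⟫ = 0) (i j : Fin n) :
    (symProd p q : Fin n → Fin n → ℝ) i j = p i * q j + q i * p j := by
  simp [symProd, h]

/-- The defect `I / n + u - v ⊗ v`. An exact solution of the Euler equations with `|v| = 1` and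
pressure `-1 / n` is a solution of the linear system with zero stress. -/
def stress (P : State n) : Matrix (Fin n) (Fin n) ℝ :=
  (n : ℝ)⁻¹ • 1 + Matrix.of P.2 - Matrix.vecMulVec P.1 P.1

/-- The interior of the convex hull of the states with `|v| = 1` and zero stress. -/
def relaxedSet (n : ℕ) : Set (State n) := {P | (stress P).PosDef}

/-- The energy defect `1 - |v|²`. -/
def defect (P : State n) : ℝ := 1 - ‖P.1‖ ^ 2

theorem isHermitian_stress (P : State n) : (stress P).IsHermitian := by
  refine Matrix.IsHermitian.ext fun i j => ?_
  simp [stress, Matrix.one_apply, Matrix.vecMulVec_apply, P.2.2.1 i j, eq_comm, mul_comm]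

theorem isOpen_relaxedSet : IsOpen (relaxedSet n) := by
  have hstress : Continuous (stress : State n → _) := by unfold stress; fun_prop
  convert isOpen_setOf_forall_dotProduct_mulVec_pos.preimage hstress using 1
  ext P
  simp only [relaxedSet, Set.mem_ofPred_eq, Matrix.posDef_iff_dotProduct_mulVec,
    isHermitian_stress P, true_and, Set.mem_preimage, star_trivial]

theorem zero_mem_relaxedSet (hn : n ≠ 0) : (0 : State n) ∈ relaxedSet n := by
  have hpos : (0 : ℝ) < (n : ℝ)⁻¹ := by positivity
  simpa [relaxedSet, stress] using Matrix.PosDef.one.smul hpos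

theorem trace_stress (hn : n ≠ 0) (P : State n) : (stress P).trace = defect P := by
  have hn' : (n : ℝ) ≠ 0 := Nat.cast_ne_zero.2 hn
  have hone : ∑ _i : Fin n, (n : ℝ)⁻¹ = 1 := by simp [hn']
  simp only [stress, defect, Matrix.trace, Matrix.diag_apply, Matrix.sub_apply, Matrix.add_apply,
    Matrix.smul_apply, Matrix.one_apply_eq, Matrix.of_apply, Matrix.vecMulVec_apply, smul_eq_mul,
    mul_one, Finset.sum_sub_distrib, Finset.sum_add_distrib, hone, P.2.2.2, add_zero,
    EuclideanSpace.real_norm_sq_eq]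
  simp only [sq]

theorem defect_pos {P : State n} (hn : n ≠ 0) (hP : P ∈ relaxedSet n) : 0 < defect P := by
  have : Nonempty (Fin n) := ⟨⟨0, Nat.pos_of_ne_zero hn⟩⟩
  exact trace_stress hn P ▸ hP.trace_pos

theorem norm_fst_lt_one {P : State n} (hn : n ≠ 0) (hP : P ∈ relaxedSet n) : ‖P.1‖ < 1 :=
  (sq_lt_one_iff₀ (norm_nonneg _)).1 (sub_pos.1 (defect_pos hn hP))

theorem stress_add_smul {P : State n} {c τ : ℝ} {e u : Space n} (heu : ⟪e, u⟫ = 0)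
    (hP : P.1 = c • e + u) :
    stress (P + τ • (e, symProd e u)) =
      stress P - (2 * τ * c + τ ^ 2) • Matrix.vecMulVec e e := by
  ext i j
  have hc (k : Fin n) : P.1 k = c * e k + u k := by simp [hP]
  simp only [stress, Prod.smul_mk, Prod.snd_add, Submodule.coe_add, SetLike.val_smul, Prod.fst_add,
    WithLp.ofLp_add, WithLp.ofLp_smul, Matrix.sub_apply, Matrix.add_apply, Matrix.smul_apply,
    smul_eq_mul, Matrix.of_apply, Pi.add_apply, Pi.smul_apply, symProd_apply heu,
    Matrix.vecMulVec_apply, hc]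
  ring

/-- Half the length of the segments around `P` provided by `exists_wave_segment`. -/
def waveAmplitude (P : State n) : ℝ := defect P / (4 * n)

theorem exists_wave_segment (hn : n ≠ 0) {P : State n} (hP : P ∈ relaxedSet n) :
    ∃ e u : Space n, ‖e‖ = 1 ∧ ⟪e, u⟫ = 0 ∧
      ∀ τ : ℝ, |τ| ≤ waveAmplitude P → P + τ • (e, symProd e u) ∈ relaxedSet n := by
  have : Nonempty (Fin n) := ⟨⟨0, Nat.pos_of_ne_zero hn⟩⟩
  have hδ := defect_pos hn hP
  obtain ⟨e, he, hpsd⟩ := exists_posSemidef_sub_smul_vecMulVec hP.posSemidef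
  rw [trace_stress hn, Fintype.card_fin] at hpsd
  set c : ℝ := ⟪e, P.1⟫
  have heu : ⟪e, P.1 - c • e⟫ = 0 := by simp [inner_sub_right, inner_smul_right, he, c]
  refine ⟨e, P.1 - c • e, he, heu, fun τ hτ => ?_⟩
  have hc : |c| ≤ 1 := (abs_real_inner_le_norm _ _).trans (by
    simpa [he] using (norm_fst_lt_one hn hP).le)
  have hδ1 : defect P ≤ 1 := sub_le_self _ (sq_nonneg _)
  have hn1 : (1 : ℝ) ≤ n := mod_cast Nat.one_le_iff_ne_zero.2 hn
  have hτ1 : |τ| ≤ 1 / 4 := hτ.trans (div_le_div₀ zero_le_one hδ1 (by norm_num) (by linarith))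
  have hτc : τ * c ≤ |τ| :=
    (le_abs_self _).trans (abs_mul τ c ▸ mul_le_of_le_one_right (abs_nonneg _) hc)
  have hτ2 : τ ^ 2 ≤ |τ| / 4 := by nlinarith [abs_nonneg τ, sq_abs τ]
  have hquarter : defect P / n = 4 * waveAmplitude P := by unfold waveAmplitude; field_simp
  have hpos : 0 < defect P / n := by positivity
  rw [relaxedSet, Set.mem_ofPred_eq, stress_add_smul heu (add_sub_cancel (c • e) P.1).symm]
  exact posDef_sub_smul_of_lt hP (posSemidef_vecMulVec_self _) hpsd (by linarith) hpos

end States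

section LinearSystem

variable {n : ℕ} {Ω : TopologicalSpace.Opens (SpaceTime n)}

/-- The space-time flux `(v, 0)` of the mass balance. -/
def massFlux : State n →L[ℝ] SpaceTime n :=
  ContinuousLinearMap.inl ℝ (Space n) ℝ ∘L ContinuousLinearMap.fst ℝ _ _

/-- The space-time flux `(uᵢ, vᵢ)` of the `i`-th momentum. -/
def momentumFlux (i : Fin n) : State n →L[ℝ] SpaceTime n :=
  ((PiLp.continuousLinearEquiv 2 ℝ fun _ : Fin n => ℝ).symm.toContinuousLinearMap ∘L
      ContinuousLinearMap.proj i ∘L (tracelessSymm n).subtypeL ∘L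
      ContinuousLinearMap.snd ℝ _ _).prod
    (EuclideanSpace.proj i ∘L ContinuousLinearMap.fst ℝ _ _)

/-- The divergence of a linear flux `T` of the states. -/
def fluxDiv (T : State n →L[ℝ] SpaceTime n) : 𝓓(Ω, State n) →ₗ[ℝ] 𝓓(Ω, ℝ) :=
  stDiv ∘ₗ (TestFunction.postcompCLM T).toLinearMap

/-- The test functions `(v, u)` which solve `∂ₜv + div u = 0`, `div v = 0`. -/
def linearSolutions (Ω : TopologicalSpace.Opens (SpaceTime n)) : Submodule ℝ 𝓓(Ω, State n) :=
  (fluxDiv massFlux).ker ⊓ ⨅ i, (fluxDiv (momentumFlux i)).ker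

theorem mem_linearSolutions {F : 𝓓(Ω, State n)} :
    F ∈ linearSolutions Ω ↔ fluxDiv massFlux F = 0 ∧ ∀ i, fluxDiv (momentumFlux i) F = 0 := by
  simp only [linearSolutions, Submodule.mem_inf, Submodule.mem_iInf, LinearMap.mem_ker]

theorem fluxDiv_smulConst (T : State n →L[ℝ] SpaceTime n) (P : State n) (g : 𝓓(Ω, ℝ)) :
    fluxDiv T (smulConst P g) = ∂_{T P} g := by
  rw [← stDiv_smulConst]
  refine congrArg stDiv (TestFunction.ext fun z => ?_)
  exact T.map_smul (g z) P

theorem momentumFlux_symProd (i : Fin n) (v : Space n) {p q : Space n} (h : ⟪p, q⟫ = 0) :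
    momentumFlux i (v, symProd p q) = (p i • q + q i • p, v i) := by
  ext j
  · exact symProd_apply h i j
  · rfl

/-- The derivative of `ψ` along `w₃`, then `w₂`, then `w₁`. -/
def thirdDeriv (w₁ w₂ w₃ : SpaceTime n) (ψ : 𝓓(Ω, ℝ)) : 𝓓(Ω, ℝ) := ∂_{w₁} (∂_{w₂} (∂_{w₃} ψ))

/-- The solution of the linear system generated by a potential `ψ`. When `e`, `ξ` are orthonormal
and orthogonal to `y`, and `ψ` oscillates along a phase whose derivatives in the directions
`(ξ, 0)`, `(e, 0)`, `(y, 1)` are `1`, `0`, `-κ`, its leading part points in the direction of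
`(e, symProd e (y + κ ξ))`. -/
def wave (e ξ y : Space n) (ψ : 𝓓(Ω, ℝ)) : 𝓓(Ω, State n) :=
  smulConst (e, symProd e y)
      (thirdDeriv (ξ, 0) (ξ, 0) (ξ, 0) ψ + thirdDeriv (ξ, 0) (e, 0) (e, 0) ψ)
    - smulConst (ξ, symProd ξ y)
      (thirdDeriv (e, 0) (ξ, 0) (ξ, 0) ψ + thirdDeriv (e, 0) (e, 0) (e, 0) ψ)
    - smulConst (0, symProd e ξ)
      (thirdDeriv (y, 1) (ξ, 0) (ξ, 0) ψ - thirdDeriv (y, 1) (e, 0) (e, 0) ψ)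
    + smulConst (0, symProd (ξ - e) (ξ + e)) (thirdDeriv (y, 1) (ξ, 0) (e, 0) ψ)

theorem wave_mem_linearSolutions {e ξ y : Space n} (he : ‖e‖ = 1) (hξ : ‖ξ‖ = 1)
    (heξ : ⟪e, ξ⟫ = 0) (hey : ⟪e, y⟫ = 0) (hξy : ⟪ξ, y⟫ = 0) (ψ : 𝓓(Ω, ℝ)) :
    wave e ξ y ψ ∈ linearSolutions Ω := by
  have hdiff : ⟪ξ - e, ξ + e⟫ = 0 := by
    rw [real_inner_comm, real_inner_add_sub_eq_zero_iff, hξ, he]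
  set a : SpaceTime n := (ξ, 0) with ha
  set b : SpaceTime n := (e, 0) with hb
  set T : SpaceTime n := (y, 1) with hT
  have hmass (v : Space n) (u : tracelessSymm n) : massFlux (v, u) = (v, 0) := rfl
  have hTa (f : 𝓓(Ω, ℝ)) : ∂_{T} (∂_{a} f) = ∂_{a} (∂_{T} f) := lineDerivOp_comm f T a
  have hTb (f : 𝓓(Ω, ℝ)) : ∂_{T} (∂_{b} f) = ∂_{b} (∂_{T} f) := lineDerivOp_comm f T b
  have hba (f : 𝓓(Ω, ℝ)) : ∂_{b} (∂_{a} f) = ∂_{a} (∂_{b} f) := lineDerivOp_comm f b a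
  refine mem_linearSolutions.2 ⟨?_, fun i => ?_⟩
  · have hzero (f : 𝓓(Ω, ℝ)) : ∂_{((0, 0) : SpaceTime n)} f = 0 := lineDerivOp_left_zero f
    simp only [wave, thirdDeriv, map_add, map_sub, fluxDiv_smulConst, hmass, ← ha, ← hb, hzero,
      lineDerivOp_add, hba]
    abel
  · have hrow₁ : momentumFlux i (e, symProd e y) = e i • T + y i • b := by
      rw [momentumFlux_symProd i e hey]; ext <;> simp [hT, hb]
    have hrow₂ : momentumFlux i (ξ, symProd ξ y) = ξ i • T + y i • a := by
      rw [momentumFlux_symProd i ξ hξy]; ext <;> simp [hT, ha]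
    have hrow₃ : momentumFlux i (0, symProd e ξ) = e i • a + ξ i • b := by
      rw [momentumFlux_symProd i 0 heξ]; ext <;> simp [ha, hb]
    have hrow₄ : momentumFlux i (0, symProd (ξ - e) (ξ + e)) = (2 * ξ i) • a - (2 * e i) • b := by
      rw [momentumFlux_symProd i 0 hdiff]
      ext
      · simp only [PiLp.sub_apply, smul_add, PiLp.add_apply, PiLp.smul_apply, smul_eq_mul, ha,
          Prod.smul_mk, mul_zero, hb, Prod.mk_sub_mk, sub_self]
        ring
      · simp [ha, hb]
    simp only [wave, thirdDeriv, map_add, map_sub, fluxDiv_smulConst, hrow₁, hrow₂, hrow₃, hrow₄,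
      ← ha, ← hb, ← hT]
    simp only [sub_eq_add_neg, ← neg_smul, lineDerivOp_left_add, lineDerivOp_left_smul,
      lineDerivOp_add, lineDerivOp_neg, hTa, hTb, hba]
    module

end LinearSystem

section Oscillation

variable {E : Type*} [NormedAddCommGroup E] [NormedSpace ℝ E] {Ω : TopologicalSpace.Opens E}

/-- The test function `x ↦ cos (k η(x) + θ) χ(x)` with amplitude `χ` and linear phase `η`. -/
def oscillation (η : E →L[ℝ] ℝ) (k : ℕ) (θ : ℝ) (χ : 𝓓(Ω, ℝ)) : 𝓓(Ω, ℝ) :=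
  smoothMul (fun x => Real.cos (k * η x + θ)) (by fun_prop) χ

theorem oscillation_apply (η : E →L[ℝ] ℝ) (k : ℕ) (θ : ℝ) (χ : 𝓓(Ω, ℝ)) (x : E) :
    oscillation η k θ χ x = Real.cos (k * η x + θ) * χ x := rfl

theorem abs_oscillation_le (η : E →L[ℝ] ℝ) (k : ℕ) (θ : ℝ) (χ : 𝓓(Ω, ℝ)) (x : E) :
    |oscillation η k θ χ x| ≤ |χ x| := by
  rw [oscillation_apply, abs_mul]
  exact mul_le_of_le_one_left (abs_nonneg _) (Real.abs_cos_le_one _)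

theorem lineDerivOp_oscillation (η : E →L[ℝ] ℝ) (k : ℕ) (θ : ℝ) (χ : 𝓓(Ω, ℝ)) (w : E) :
    ∂_{w} (oscillation η k θ χ) =
      oscillation η k θ (∂_{w} χ) + (k * η w) • oscillation η k (θ + Real.pi / 2) χ := by
  ext x
  have hphase : HasFDerivAt (fun x => k * η x + θ) ((k : ℝ) • η) x :=
    (η.hasFDerivAt.const_mul (k : ℝ)).add_const θ
  have hχ : HasFDerivAt χ (fderiv ℝ χ x) x :=
    (χ.contDiff.differentiable (by simp)).differentiableAt.hasFDerivAt
  have hprod : HasFDerivAt (oscillation η k θ χ) _ x := hphase.cos.mul hχ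
  simp only [lineDerivOp_apply, hprod.fderiv, FunLike.coe_add, FunLike.coe_smul, Pi.add_apply,
    Pi.smul_apply, smul_eq_mul, oscillation_apply, ← add_assoc, Real.cos_add_pi_div_two]
  ring

theorem tendsto_iteratedLineDerivOp_oscillation (η : E →L[ℝ] ℝ) {r : ℕ} (m : Fin r → E) (θ : ℝ)
    (χ : 𝓓(Ω, ℝ)) :
    Tendsto (fun q : ℕ × E => ((q.1 : ℝ) ^ r)⁻¹ * (∂^{m} (oscillation η q.1 θ χ)) q.2
        - (∏ i, η (m i)) * oscillation η q.1 (θ + r * (Real.pi / 2)) χ q.2)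
      (atTop ×ˢ ⊤) (𝓝 0) := by
  induction r generalizing θ χ with
  | zero => simp [iteratedLineDerivOp_fin_zero]
  | succ r ih =>
    have hinv : Tendsto (fun q : ℕ × E => (q.1 : ℝ)⁻¹) (atTop ×ˢ ⊤) (𝓝 0) :=
      (tendsto_inv_atTop_nhds_zero_nat (𝕜 := ℝ)).comp tendsto_fst
    have hlower : Tendsto (fun q : ℕ × E => (q.1 : ℝ)⁻¹ *
        (((q.1 : ℝ) ^ r)⁻¹ * (∂^{Fin.init m} (oscillation η q.1 θ (∂_{m (Fin.last r)} χ))) q.2))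
        (atTop ×ˢ ⊤) (𝓝 0) := by
      obtain ⟨C, hC⟩ := (∂_{m (Fin.last r)} χ).hasCompactSupport.exists_bound_of_continuous
        (∂_{m (Fin.last r)} χ).continuous
      have hlead := hinv.zero_mul_isBoundedUnder_le (g := fun q : ℕ × E =>
        oscillation η q.1 (θ + r * (Real.pi / 2)) (∂_{m (Fin.last r)} χ) q.2)
        (isBoundedUnder_of ⟨C, fun q => (abs_oscillation_le _ _ _ _ _).trans (hC q.2)⟩)
      have h := (hinv.mul (ih (Fin.init m) θ (∂_{m (Fin.last r)} χ))).add
        (hlead.const_mul (∏ i, η (Fin.init m i)))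
      simp only [mul_zero, add_zero] at h
      exact h.congr fun q => by ring
    have h := hlower.add ((ih (Fin.init m) (θ + Real.pi / 2) χ).const_mul (η (m (Fin.last r))))
    rw [mul_zero, add_zero] at h
    refine h.congr' ?_
    filter_upwards [tendsto_fst.eventually (eventually_ne_atTop 0)] with q hq
    have hq' : (q.1 : ℝ) ≠ 0 := Nat.cast_ne_zero.2 hq
    have hphase : θ + Real.pi / 2 + r * (Real.pi / 2) = θ + (r + 1 : ℕ) * (Real.pi / 2) := by
      push_cast; ring
    simp only [iteratedLineDerivOp_succ_right, lineDerivOp_oscillation, iteratedLineDerivOp_add,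
      iteratedLineDerivOp_smul, hphase, FunLike.coe_add, FunLike.coe_smul, Pi.add_apply,
      Pi.smul_apply, smul_eq_mul, Fin.prod_univ_castSucc, Fin.init]
    field_simp
    ring

end Oscillation

section ModulatedWaves

variable {E V : Type*} [NormedAddCommGroup E] {Ω : TopologicalSpace.Opens E}

theorem tendsto_integral_of_tendsto_prod_top {α G : Type*} [MeasurableSpace α] {μ : Measure α}
    [NormedAddCommGroup G] [NormedSpace ℝ G] {S : Set α} (hS : μ S ≠ ⊤) {f : ℕ → α → G}
    (hf : ∀ k, ∀ x ∉ S, f k x = 0)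
    (hlim : Tendsto (fun q : ℕ × α => f q.1 q.2) (atTop ×ˢ ⊤) (𝓝 0)) :
    Tendsto (fun k => ∫ x, f k x ∂μ) atTop (𝓝 0) := by
  have hunif := Metric.tendstoUniformly_iff.1 (tendsto_prod_top_iff.1 hlim)
  refine Metric.tendsto_nhds.2 fun ε hε => ?_
  have hpos : 0 < μ.real S + 1 := by positivity
  filter_upwards [hunif (ε / (μ.real S + 1)) (by positivity)] with k hk
  rw [← setIntegral_eq_integral_of_forall_compl_eq_zero (hf k), dist_zero_right]
  have hbound := norm_setIntegral_le_of_norm_le_const hS.lt_top fun x (_ : x ∈ S) =>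
    (dist_zero_left (f k x)).ge.trans (hk x).le
  refine hbound.trans_lt ?_
  rw [div_mul_eq_mul_div, div_lt_iff₀ hpos]
  gcongr
  linarith

variable [NormedSpace ℝ E]

theorem tendsto_integral_cos_mul [FiniteDimensional ℝ E] [MeasurableSpace E] [BorelSpace E]
    {μ : Measure E} [μ.IsAddHaarMeasure] {η : E →L[ℝ] ℝ} (hη : η ≠ 0) {f : E → ℝ}
    (hf : Integrable f μ) :
    Tendsto (fun k : ℕ => ∫ x, Real.cos (k * η x) * f x ∂μ) atTop (𝓝 0) := by
  have hfreq : Tendsto (fun k : ℕ => -((k : ℝ) / (2 * Real.pi)) • η) atTop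
      (cocompact (StrongDual ℝ E)) := by
    rw [← Metric.cobounded_eq_cocompact, ← tendsto_norm_atTop_iff_cobounded]
    have hnorm (k : ℕ) : ‖-((k : ℝ) / (2 * Real.pi)) • η‖ = k * (‖η‖ / (2 * Real.pi)) := by
      rw [norm_smul, norm_neg, Real.norm_of_nonneg (by positivity)]
      ring
    simp only [hnorm]
    exact tendsto_natCast_atTop_atTop.atTop_mul_const (by positivity)
  have h := (tendsto_integral_exp_smul_cocompact (fun x => (f x : ℂ)) μ).comp hfreq
  refine ((Complex.continuous_re.tendsto 0).comp h).congr fun k => ?_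
  have hint : Integrable (fun x => Real.fourierChar (-(-((k : ℝ) / (2 * Real.pi)) • η) x) •
      (f x : ℂ)) μ := by
    refine hf.ofReal.bdd_mul (c := 1) (Continuous.aestronglyMeasurable ?_)
      (.of_forall fun x => (Circle.norm_coe _).le)
    exact continuous_subtype_val.comp (Real.continuous_fourierChar.comp (by fun_prop))
  refine (integral_re hint).symm.trans (integral_congr_ae (.of_forall fun x => ?_))
  have hphase : 2 * Real.pi * -(-((k : ℝ) / (2 * Real.pi)) • η) x = k * η x := by
    rw [FunLike.coe_smul, Pi.smul_apply, smul_eq_mul]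
    field_simp
  simp only [Circle.smul_def, smul_eq_mul, Real.fourierChar_apply, hphase, RCLike.re_eq_complex_re,
    Complex.re_mul_ofReal, Complex.exp_ofReal_mul_I_re]

/-- The test functions `w k` are uniformly asymptotic to the plane waves `cos (k η) χ P`, and
supported where the amplitude `χ` is. -/
structure IsModulatedWave [NormedAddCommGroup V] [NormedSpace ℝ V] (w : ℕ → 𝓓(Ω, V))
    (η : E →L[ℝ] ℝ) (χ : 𝓓(Ω, ℝ)) (P : V) : Prop where
  tendsto : Tendsto (fun q : ℕ × E => w q.1 q.2 - smulConst P (oscillation η q.1 0 χ) q.2)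
    (atTop ×ˢ ⊤) (𝓝 0)
  tsupport_subset : ∀ k, tsupport (w k) ⊆ tsupport χ

namespace IsModulatedWave

theorem postcomp {V' : Type*} [NormedAddCommGroup V] [NormedSpace ℝ V]
    [NormedAddCommGroup V'] [NormedSpace ℝ V'] {w : ℕ → 𝓓(Ω, V)} {η : E →L[ℝ] ℝ} {χ : 𝓓(Ω, ℝ)}
    {P : V} (hw : IsModulatedWave w η χ P) (T : V →L[ℝ] V') :
    IsModulatedWave (fun k => TestFunction.postcompCLM T (w k)) η χ (T P) where
  tendsto := by
    have h := (T.continuous.tendsto 0).comp hw.tendsto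
    rw [T.map_zero] at h
    exact h.congr fun q => by
      rw [Function.comp_apply, T.map_sub, smulConst_apply, T.map_smul]; rfl
  tsupport_subset k := (tsupport_comp_subset T.map_zero (w k)).trans (hw.tsupport_subset k)

variable [NormedAddCommGroup V] [InnerProductSpace ℝ V] {w : ℕ → 𝓓(Ω, V)} {η : E →L[ℝ] ℝ}
  {χ : 𝓓(Ω, ℝ)} {P : V}

theorem sub_eq_zero_of_notMem (hw : IsModulatedWave w η χ P) (k : ℕ) {x : E}
    (hx : x ∉ tsupport χ) : w k x - smulConst P (oscillation η k 0 χ) x = 0 := by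
  rw [image_eq_zero_of_notMem_tsupport fun h => hx (hw.tsupport_subset k h), smulConst_apply,
    oscillation_apply, image_eq_zero_of_notMem_tsupport hx, mul_zero, zero_smul, sub_zero]

variable [FiniteDimensional ℝ E] [MeasurableSpace E] [BorelSpace E] (μ : Measure E)
  [μ.IsAddHaarMeasure]

theorem tendsto_integral_inner (hw : IsModulatedWave w η χ P) (hη : η ≠ 0) (G : 𝓓(Ω, V)) :
    Tendsto (fun k => ∫ x, ⟪G x, w k x⟫ ∂μ) atTop (𝓝 0) := by
  obtain ⟨C, hC⟩ := G.hasCompactSupport.exists_bound_of_continuous G.continuous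
  have herror : Tendsto (fun k => ∫ x, ⟪G x, w k x - smulConst P (oscillation η k 0 χ) x⟫ ∂μ)
      atTop (𝓝 0) := by
    refine tendsto_integral_of_tendsto_prod_top χ.hasCompactSupport.measure_lt_top.ne
      (fun k x hx => by rw [hw.sub_eq_zero_of_notMem k hx, inner_zero_right]) ?_
    have hlim := hw.tendsto.norm.const_mul C
    rw [norm_zero, mul_zero] at hlim
    exact squeeze_zero_norm (fun q => (norm_inner_le_norm _ _).trans (by gcongr; exact hC _)) hlim
  have hlead : Tendsto (fun k => ∫ x, ⟪G x, smulConst P (oscillation η k 0 χ) x⟫ ∂μ) atTop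
      (𝓝 0) := by
    refine (tendsto_integral_cos_mul (μ := μ) hη (integrable_inner G (smulConst P χ))).congr
      fun k => integral_congr_ae (.of_forall fun x => ?_)
    simp only [smulConst_apply, inner_smul_right, oscillation_apply, add_zero]
    ring
  have h := herror.add hlead
  rw [add_zero] at h
  refine h.congr fun k => ?_
  let y := smulConst P (oscillation η k 0 χ)
  refine (integral_add (integrable_inner G (w k - y)) (integrable_inner G y)).symm.trans ?_
  refine integral_congr_ae (.of_forall fun x => ?_)
  simp only [← inner_add_right, FunLike.coe_sub, Pi.sub_apply, sub_add_cancel]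

end IsModulatedWave

theorem tendsto_integral_oscillation_sq [FiniteDimensional ℝ E] [MeasurableSpace E] [BorelSpace E]
    (μ : Measure E) [μ.IsAddHaarMeasure] {η : E →L[ℝ] ℝ} (hη : η ≠ 0) (χ : 𝓓(Ω, ℝ)) :
    Tendsto (fun k => ∫ x, oscillation η k 0 χ x ^ 2 ∂μ) atTop (𝓝 ((∫ x, χ x ^ 2 ∂μ) / 2)) := by
  have hχ : Integrable (fun x => χ x ^ 2) μ :=
    integrable_comp χ (continuous_pow 2) (zero_pow two_ne_zero)
  have h := ((tendsto_integral_cos_mul (smul_ne_zero two_ne_zero hη : (2 : ℝ) • η ≠ 0) hχ).add_const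
    (∫ x, χ x ^ 2 ∂μ)).div_const 2
  rw [zero_add] at h
  refine h.congr fun k => ?_
  rw [← integral_add _ hχ, ← integral_div]
  · refine integral_congr_ae (.of_forall fun x => ?_)
    have hphase : (k : ℝ) * ((2 : ℝ) • η) x = 2 * (k * η x) := by
      rw [FunLike.coe_smul, Pi.smul_apply, smul_eq_mul]; ring
    simp only [oscillation_apply, add_zero, mul_pow, Real.cos_sq, hphase]
    ring
  · exact hχ.bdd_mul (c := 1) (by fun_prop) (.of_forall fun x => Real.abs_cos_le_one _)

theorem IsModulatedWave.tendsto_integral_norm_sq [NormedAddCommGroup V] [InnerProductSpace ℝ V]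
    [FiniteDimensional ℝ E] [MeasurableSpace E] [BorelSpace E] (μ : Measure E)
    [μ.IsAddHaarMeasure] {w : ℕ → 𝓓(Ω, V)} {η : E →L[ℝ] ℝ} {χ : 𝓓(Ω, ℝ)} {P : V}
    (hw : IsModulatedWave w η χ P) (hη : η ≠ 0) :
    Tendsto (fun k => ∫ x, ‖w k x‖ ^ 2 ∂μ) atTop (𝓝 (‖P‖ ^ 2 * ((∫ x, χ x ^ 2 ∂μ) / 2))) := by
  obtain ⟨C, hC⟩ := χ.hasCompactSupport.exists_bound_of_continuous χ.continuous
  have herror : Tendsto (fun k => ∫ x, (‖w k x‖ ^ 2 - ‖smulConst P (oscillation η k 0 χ) x‖ ^ 2) ∂μ)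
      atTop (𝓝 0) := by
    refine tendsto_integral_of_tendsto_prod_top χ.hasCompactSupport.measure_lt_top.ne
      (fun k x hx => by rw [sub_eq_zero.1 (hw.sub_eq_zero_of_notMem k hx), sub_self]) ?_
    have hd := hw.tendsto.norm
    rw [norm_zero] at hd
    have hlim := (hd.const_mul (2 * (C * ‖P‖))).add (hd.pow 2)
    simp only [mul_zero, ne_eq, OfNat.ofNat_ne_zero, not_false_eq_true, zero_pow, add_zero] at hlim
    refine squeeze_zero_norm (fun q => ?_) hlim
    set y := smulConst P (oscillation η q.1 0 χ) q.2 with hy_def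
    have hy : ‖y‖ ≤ C * ‖P‖ := by
      rw [hy_def, smulConst_apply, norm_smul]
      gcongr
      exact (abs_oscillation_le _ _ _ _ _).trans (hC _)
    have hexpand : ‖w q.1 q.2‖ ^ 2 - ‖y‖ ^ 2
        = 2 * ⟪y, w q.1 q.2 - y⟫ + ‖w q.1 q.2 - y‖ ^ 2 := by
      have h := norm_add_sq_real y (w q.1 q.2 - y)
      rw [add_sub_cancel] at h
      linarith
    rw [hexpand]
    refine (norm_add_le _ _).trans ?_
    rw [norm_mul, norm_pow, norm_norm, mul_assoc, Real.norm_ofNat]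
    gcongr
    exact (norm_inner_le_norm _ _).trans (by gcongr)
  have h := herror.add ((tendsto_integral_oscillation_sq μ hη χ).const_mul (‖P‖ ^ 2))
  rw [zero_add] at h
  refine h.congr fun k => ?_
  rw [← integral_const_mul]
  have hy (x : E) : ‖P‖ ^ 2 * oscillation η k 0 χ x ^ 2
      = ‖smulConst P (oscillation η k 0 χ) x‖ ^ 2 := by
    rw [smulConst_apply, norm_smul, mul_pow, Real.norm_eq_abs, sq_abs, mul_comm]
  simp only [hy]
  refine (integral_add ((integrable_norm_sq (w k)).sub (integrable_norm_sq _))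
    (integrable_norm_sq _)).symm.trans ?_
  exact integral_congr_ae (.of_forall fun x => sub_add_cancel _ _)

end ModulatedWaves

section PlaneWaves

variable {n : ℕ} {Ω : TopologicalSpace.Opens (SpaceTime n)}

theorem tsupport_lineDerivOp_subset {E F : Type*} [NormedAddCommGroup E] [NormedSpace ℝ E]
    [NormedAddCommGroup F] [NormedSpace ℝ F] {Ω : TopologicalSpace.Opens E} (f : 𝓓(Ω, F)) (w : E) :
    tsupport (∂_{w} f : 𝓓(Ω, F)) ⊆ tsupport f := by
  have hcoe : ((∂_{w} f : 𝓓(Ω, F)) : E → F) = fun x => fderiv ℝ f x w :=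
    funext (lineDerivOp_apply f w)
  rw [hcoe]
  exact tsupport_fderiv_apply_subset ℝ w

theorem symProd_add_smul (p q r : Space n) (c : ℝ) :
    symProd p (q + c • r) = symProd p q + c • symProd p r := by
  ext i j
  simp only [symProd, PiLp.add_apply, PiLp.smul_apply, smul_eq_mul, inner_add_right,
    inner_smul_right, Submodule.coe_add, SetLike.val_smul, Pi.add_apply, Pi.smul_apply]
  split_ifs <;> ring

theorem wave_apply (e ξ y : Space n) (ψ : 𝓓(Ω, ℝ)) (z : SpaceTime n) :
    wave e ξ y ψ z =
      (thirdDeriv (ξ, 0) (ξ, 0) (ξ, 0) ψ z + thirdDeriv (ξ, 0) (e, 0) (e, 0) ψ z)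
          • (e, symProd e y)
        - (thirdDeriv (e, 0) (ξ, 0) (ξ, 0) ψ z + thirdDeriv (e, 0) (e, 0) (e, 0) ψ z)
          • (ξ, symProd ξ y)
        - (thirdDeriv (y, 1) (ξ, 0) (ξ, 0) ψ z - thirdDeriv (y, 1) (e, 0) (e, 0) ψ z)
          • (0, symProd e ξ)
        + thirdDeriv (y, 1) (ξ, 0) (e, 0) ψ z • (0, symProd (ξ - e) (ξ + e)) := rfl

theorem tsupport_wave_subset (e ξ y : Space n) (ψ : 𝓓(Ω, ℝ)) :
    tsupport (wave e ξ y ψ) ⊆ tsupport ψ := by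
  refine closure_minimal (fun z hz => ?_) (isClosed_tsupport ψ)
  contrapose! hz
  have hzero (w₁ w₂ w₃ : SpaceTime n) : thirdDeriv w₁ w₂ w₃ ψ z = 0 :=
    image_eq_zero_of_notMem_tsupport fun h => hz <| tsupport_lineDerivOp_subset _ _ <|
      tsupport_lineDerivOp_subset _ _ <| tsupport_lineDerivOp_subset _ _ h
  rw [Function.notMem_support, wave_apply]
  simp only [hzero, add_zero, sub_zero, zero_smul]

/-- The linear phase `⟪ξ, x⟫ - κ t`. -/
def phase (ξ : Space n) (κ : ℝ) : SpaceTime n →L[ℝ] ℝ :=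
  innerSL ℝ ξ ∘L ContinuousLinearMap.fst ℝ (Space n) ℝ - κ • ContinuousLinearMap.snd ℝ (Space n) ℝ

theorem phase_apply (ξ : Space n) (κ : ℝ) (x : Space n) (t : ℝ) :
    phase ξ κ (x, t) = ⟪ξ, x⟫ - κ * t := rfl

/-- The potential whose third derivatives are asymptotic to multiples of `cos (k η) χ`. -/
def potential (η : SpaceTime n →L[ℝ] ℝ) (k : ℕ) (χ : 𝓓(Ω, ℝ)) : 𝓓(Ω, ℝ) :=
  ((k : ℝ) ^ 3)⁻¹ • oscillation η k (Real.pi / 2) χ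

theorem tsupport_potential_subset (η : SpaceTime n →L[ℝ] ℝ) (k : ℕ) (χ : 𝓓(Ω, ℝ)) :
    tsupport (potential η k χ) ⊆ tsupport χ :=
  closure_mono fun _ hz h₀ => hz (by simp [potential, oscillation_apply, h₀])

theorem tendsto_thirdDeriv_potential (η : SpaceTime n →L[ℝ] ℝ) (χ : 𝓓(Ω, ℝ))
    (w₁ w₂ w₃ : SpaceTime n) :
    Tendsto (fun q : ℕ × SpaceTime n => thirdDeriv w₁ w₂ w₃ (potential η q.1 χ) q.2
      - η w₁ * η w₂ * η w₃ * oscillation η q.1 0 χ q.2) (atTop ×ˢ ⊤) (𝓝 0) := by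
  refine (tendsto_iteratedLineDerivOp_oscillation η ![w₁, w₂, w₃] (Real.pi / 2) χ).congr
    fun q => ?_
  have hphase : oscillation η q.1 (Real.pi / 2 + (3 : ℕ) * (Real.pi / 2)) χ q.2
      = oscillation η q.1 0 χ q.2 := by
    rw [oscillation_apply, oscillation_apply, add_zero, ← Real.cos_add_two_pi (q.1 * η q.2)]
    congr 2
    push_cast
    ring
  rw [hphase]
  simp only [thirdDeriv, potential, lineDerivOp_smul, iteratedLineDerivOp_succ_left,
    Fin.prod_univ_three]
  rfl

theorem isModulatedWave_wave {e ξ y : Space n} (hξ : ‖ξ‖ = 1) (heξ : ⟪e, ξ⟫ = 0)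
    (hξy : ⟪ξ, y⟫ = 0) (κ : ℝ) (χ : 𝓓(Ω, ℝ)) :
    IsModulatedWave (fun k => wave e ξ y (potential (phase ξ κ) k χ)) (phase ξ κ) χ
      (e, symProd e (y + κ • ξ)) where
  tsupport_subset k := (tsupport_wave_subset e ξ y _).trans (tsupport_potential_subset _ k χ)
  tendsto := by
    have ha : phase ξ κ (ξ, 0) = 1 := by
      rw [phase_apply, real_inner_self_eq_norm_sq, hξ]; norm_num
    have hb : phase ξ κ (e, 0) = 0 := by rw [phase_apply, real_inner_comm, heξ]; norm_num
    have hT : phase ξ κ (y, 1) = -κ := by rw [phase_apply, hξy]; ring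
    have hlim := tendsto_thirdDeriv_potential (phase ξ κ) χ
    have h := (((((hlim (ξ, 0) (ξ, 0) (ξ, 0)).add (hlim (ξ, 0) (e, 0) (e, 0))).smul_const
        ((e, symProd e y) : State n)).sub
      (((hlim (e, 0) (ξ, 0) (ξ, 0)).add (hlim (e, 0) (e, 0) (e, 0))).smul_const
        ((ξ, symProd ξ y) : State n))).sub
      (((hlim (y, 1) (ξ, 0) (ξ, 0)).sub (hlim (y, 1) (e, 0) (e, 0))).smul_const
        ((0, symProd e ξ) : State n))).add
      ((hlim (y, 1) (ξ, 0) (e, 0)).smul_const ((0, symProd (ξ - e) (ξ + e)) : State n))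
    simp only [ha, hb, hT, add_zero, sub_zero, zero_smul] at h
    refine h.congr fun q => ?_
    have hlead : ((e, symProd e (y + κ • ξ)) : State n)
        = (e, symProd e y) + κ • (0, symProd e ξ) := by
      rw [symProd_add_smul, Prod.smul_mk, Prod.mk_add_mk, smul_zero, add_zero]
    rw [wave_apply, smulConst_apply, hlead]
    module

theorem exists_unit_orthogonal (hn : 2 ≤ n) (e : Space n) :
    ∃ ξ : Space n, ‖ξ‖ = 1 ∧ ⟪e, ξ⟫ = 0 := by
  have hne : Submodule.span ℝ {e} ≠ ⊤ := fun h => by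
    have hle := finrank_span_le_card (R := ℝ) ({e} : Set (Space n))
    rw [h, finrank_top, finrank_euclideanSpace_fin, Set.toFinset_singleton,
      Finset.card_singleton] at hle
    omega
  obtain ⟨x, hx, hx₀⟩ :=
    Submodule.exists_mem_ne_zero_of_ne_bot (Submodule.orthogonal_eq_bot_iff.not.2 hne)
  refine ⟨‖x‖⁻¹ • x, norm_smul_inv_norm hx₀, ?_⟩
  rw [inner_smul_right, Submodule.mem_orthogonal_singleton_iff_inner_right.1 hx, mul_zero]

theorem exists_isModulatedWave (hn : 2 ≤ n) {e u : Space n} (he : ‖e‖ = 1) (heu : ⟪e, u⟫ = 0) :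
    ∃ η : SpaceTime n →L[ℝ] ℝ, η ≠ 0 ∧ ∀ χ : 𝓓(Ω, ℝ), ∃ w : ℕ → 𝓓(Ω, State n),
      (∀ k, w k ∈ linearSolutions Ω) ∧ IsModulatedWave w η χ (e, symProd e u) := by
  obtain ⟨ξ, hξ, heξ⟩ := exists_unit_orthogonal hn e
  have hξξ : ⟪ξ, ξ⟫ = 1 := by rw [real_inner_self_eq_norm_sq, hξ, one_pow]
  set κ := ⟪ξ, u⟫
  have hξy : ⟪ξ, u - κ • ξ⟫ = 0 := by rw [inner_sub_right, inner_smul_right, hξξ, mul_one, sub_self]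
  have hey : ⟪e, u - κ • ξ⟫ = 0 := by
    rw [inner_sub_right, inner_smul_right, heu, heξ, mul_zero, sub_zero]
  refine ⟨phase ξ κ, fun h₀ => ?_, fun χ => ⟨fun k =>
    wave e ξ (u - κ • ξ) (potential (phase ξ κ) k χ), fun k =>
      wave_mem_linearSolutions he hξ heξ hey hξy _, ?_⟩⟩
  · have h := congrArg (fun η => η (ξ, 0)) h₀
    simp [phase_apply, hξ] at h
  · simpa only [sub_add_cancel] using isModulatedWave_wave hξ heξ hξy κ χ

end PlaneWaves

section LocalPerturbation

theorem exists_bump_integral_sq_ge {E : Type*} [NormedAddCommGroup E] [NormedSpace ℝ E]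
    [HasContDiffBump E] [FiniteDimensional ℝ E] [MeasurableSpace E] [BorelSpace E]
    (μ : Measure E) [μ.IsAddHaarMeasure] {Ω : TopologicalSpace.Opens E} {x : E} {r : ℝ}
    (hr : 0 < r) (hΩ : Metric.closedBall x r ⊆ Ω) :
    ∃ b : 𝓓(Ω, ℝ), tsupport b ⊆ Metric.closedBall x r ∧ (∀ y, |b y| ≤ 1) ∧
      2⁻¹ ^ Module.finrank ℝ E * μ.real (Metric.closedBall x r) ≤ ∫ y, b y ^ 2 ∂μ := by
  let c : ContDiffBump x := ⟨r / 2, r, half_pos hr, half_lt_self hr⟩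
  let b : 𝓓(Ω, ℝ) := ⟨c, c.contDiff, c.hasCompactSupport, c.tsupport_eq.trans_subset hΩ⟩
  have hle (y : E) : |b y| ≤ 1 := (abs_of_nonneg c.nonneg).trans_le c.le_one
  refine ⟨b, c.tsupport_eq.subset, hle, ?_⟩
  have hvol : μ.real (Metric.closedBall x (r / 2))
      = 2⁻¹ ^ Module.finrank ℝ E * μ.real (Metric.closedBall x r) := by
    rw [div_eq_inv_mul, measureReal_def, Measure.addHaar_closedBall_mul μ x (by norm_num) hr.le,
      ENNReal.toReal_mul, ENNReal.toReal_ofReal (by positivity), measureReal_def,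
      Measure.addHaar_closedBall_center μ x r]
  calc 2⁻¹ ^ Module.finrank ℝ E * μ.real (Metric.closedBall x r)
      = ∫ _ in Metric.closedBall x (r / 2), (1 : ℝ) ∂μ := by
        rw [setIntegral_const, smul_eq_mul, mul_one, hvol]
    _ = ∫ y in Metric.closedBall x (r / 2), b y ^ 2 ∂μ :=
        setIntegral_congr_fun Metric.isClosed_closedBall.measurableSet fun y hy => by
          have hone : b y = 1 := c.one_of_mem_closedBall hy
          simp only [hone, one_pow]
    _ ≤ ∫ y, b y ^ 2 ∂μ :=
        setIntegral_le_integral (integrable_comp b (continuous_pow 2) (zero_pow two_ne_zero))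
          (.of_forall fun y => sq_nonneg _)

theorem eventually_forall_abs_le_add_smul_mem {V : Type*} [NormedAddCommGroup V] [NormedSpace ℝ V]
    {U : Set V} (hU : IsOpen U) {x P : V} {s : ℝ} (h : ∀ τ : ℝ, |τ| ≤ s → x + τ • P ∈ U) :
    ∀ᶠ q : V × V in 𝓝 x ×ˢ 𝓝 0, ∀ τ : ℝ, |τ| ≤ s → q.1 + (τ • P + q.2) ∈ U := by
  have hcont : Continuous fun p : (V × V) × ℝ => p.1.1 + (p.2 • P + p.1.2) := by fun_prop
  have hnear : ∀ τ ∈ Set.Icc (-s) s, ∀ᶠ p : (V × V) × ℝ in 𝓝 ((x, 0), τ),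
      p.1.1 + (p.2 • P + p.1.2) ∈ U := fun τ hτ => by
    refine hcont.continuousAt.eventually (hU.mem_nhds ?_)
    simpa only [add_zero] using h τ (abs_le.2 hτ)
  rw [← nhds_prod_eq]
  filter_upwards [isCompact_Icc.eventually_forall_of_forall_eventually
    (P := fun q τ => q.1 + (τ • P + q.2) ∈ U) hnear] with q hq τ hτ
  exact hq τ (abs_le.1 hτ)

variable {n : ℕ} {Ω : TopologicalSpace.Opens (SpaceTime n)}

/-- The projection of state-valued test functions to their velocity components. -/
def velocity : 𝓓(Ω, State n) →L[ℝ] 𝓓(Ω, Space n) :=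
  TestFunction.postcompCLM (ContinuousLinearMap.fst ℝ _ _)

theorem velocity_apply (F : 𝓓(Ω, State n)) (z : SpaceTime n) : velocity F z = (F z).1 := rfl

/-- The sequence `w` consists of perturbations of the subsolution `F` supported in `S`, whose
velocities tend weakly to zero and eventually have at least the energy `g`. -/
structure IsPerturbation (F : 𝓓(Ω, State n)) (S : Set (SpaceTime n)) (g : ℝ)
    (w : ℕ → 𝓓(Ω, State n)) : Prop where
  mem_linearSolutions : ∀ k, w k ∈ linearSolutions Ω
  eq_zero : ∀ k, ∀ z ∉ S, w k z = 0
  eventually_mem_relaxedSet : ∀ᶠ k in atTop, ∀ z, F z + w k z ∈ relaxedSet n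
  eventually_le_integral : ∀ᶠ k in atTop, g ≤ ∫ z, ‖velocity (w k) z‖ ^ 2
  tendsto_integral_inner : ∀ G : 𝓓(Ω, Space n),
    Tendsto (fun k => ∫ z, ⟪G z, velocity (w k) z⟫) atTop (𝓝 0)

/-- The fraction of the integral of the squared defect over a small ball which the energy of a
perturbation supported in the ball can reach. -/
def gainConst (n : ℕ) : ℝ := 2⁻¹ ^ Module.finrank ℝ (SpaceTime n) / (256 * (n : ℝ) ^ 2)

theorem gainConst_pos (hn : n ≠ 0) : 0 < gainConst n := by
  unfold gainConst
  positivity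

@[fun_prop]
theorem continuous_defect : Continuous (defect (n := n)) := by
  unfold defect
  fun_prop

theorem gainConst_mul_setIntegral_le (hn : n ≠ 0) (F : 𝓓(Ω, State n)) {z₀ : SpaceTime n} {r : ℝ}
    (h : ∀ z ∈ Metric.closedBall z₀ r, defect (F z) ^ 2 ≤ (2 * defect (F z₀)) ^ 2) :
    gainConst n * ∫ z in Metric.closedBall z₀ r, defect (F z) ^ 2
      ≤ waveAmplitude (F z₀) ^ 2 / 4 *
        (2⁻¹ ^ Module.finrank ℝ (SpaceTime n) * volume.real (Metric.closedBall z₀ r)) := by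
  have hcont : Continuous fun z => defect (F z) ^ 2 := by
    have := F.continuous
    fun_prop
  have hle : ∫ z in Metric.closedBall z₀ r, defect (F z) ^ 2
      ≤ ∫ _ in Metric.closedBall z₀ r, (2 * defect (F z₀)) ^ 2 :=
    setIntegral_mono_on (hcont.continuousOn.integrableOn_compact (isCompact_closedBall z₀ r))
      (integrableOn_const measure_closedBall_lt_top.ne)
      Metric.isClosed_closedBall.measurableSet h
  rw [setIntegral_const, smul_eq_mul] at hle
  refine (mul_le_mul_of_nonneg_left hle (gainConst_pos hn).le).trans_eq ?_
  rw [gainConst, waveAmplitude]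
  field_simp
  linarith

theorem IsModulatedWave.isPerturbation {F : 𝓓(Ω, State n)}
    (hF : ∀ z, F z ∈ relaxedSet n) {w : ℕ → 𝓓(Ω, State n)} {η : SpaceTime n →L[ℝ] ℝ}
    {χ : 𝓓(Ω, ℝ)} {P : State n} (hw : IsModulatedWave w η χ P) (hη : η ≠ 0)
    (hmem : ∀ k, w k ∈ linearSolutions Ω) {S : Set (SpaceTime n)} (hS : tsupport χ ⊆ S) {s : ℝ}
    (hχ : ∀ z, |χ z| ≤ s) {g : ℝ} (hg : g < ‖P.1‖ ^ 2 * ((∫ z, χ z ^ 2) / 2))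
    {N : Set (State n)} (hN : N ∈ 𝓝 0)
    (hseg : ∀ z ∈ S, ∀ y ∈ N, ∀ τ : ℝ, |τ| ≤ s → F z + (τ • P + y) ∈ relaxedSet n) :
    IsPerturbation F S g w where
  mem_linearSolutions := hmem
  eq_zero k z hz :=
    image_eq_zero_of_notMem_tsupport fun h => hz (hS (hw.tsupport_subset k h))
  eventually_mem_relaxedSet := by
    filter_upwards [(hw.tendsto.eventually hN).curry] with k hk z
    by_cases hz : z ∈ S
    · have h := hseg z hz _ (Filter.eventually_top.1 hk z) (oscillation η k 0 χ z)
        ((abs_oscillation_le _ _ _ _ _).trans (hχ z))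
      rwa [smulConst_apply, add_sub_cancel] at h
    · rw [image_eq_zero_of_notMem_tsupport fun h => hz (hS (hw.tsupport_subset k h)), add_zero]
      exact hF z
  eventually_le_integral := by
    filter_upwards [((hw.postcomp (ContinuousLinearMap.fst ℝ _ _)).tendsto_integral_norm_sq volume
      hη).eventually_const_lt hg] with k hk
    exact hk.le
  tendsto_integral_inner :=
    (hw.postcomp (ContinuousLinearMap.fst ℝ _ _)).tendsto_integral_inner volume hη

theorem eventually_exists_isPerturbation_closedBall (hn : 2 ≤ n) {F : 𝓓(Ω, State n)}
    (hF : ∀ z, F z ∈ relaxedSet n) {z₀ : SpaceTime n} (hz₀ : z₀ ∈ Ω) :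
    ∀ᶠ r in 𝓝[>] (0 : ℝ), ∃ w, IsPerturbation F (Metric.closedBall z₀ r)
      (gainConst n * ∫ z in Metric.closedBall z₀ r, defect (F z) ^ 2) w := by
  have hn0 : n ≠ 0 := by omega
  obtain ⟨e, u, he, heu, hseg⟩ := exists_wave_segment hn0 (hF z₀)
  obtain ⟨η, hη, hwave⟩ := exists_isModulatedWave (Ω := Ω) hn he heu
  have hs : 0 < waveAmplitude (F z₀) := by
    have := defect_pos hn0 (hF z₀)
    unfold waveAmplitude
    positivity
  have hdefect : ∀ᶠ z in 𝓝 z₀, defect (F z) ^ 2 < (2 * defect (F z₀)) ^ 2 := by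
    have := F.continuous
    have hcont : ContinuousAt (fun z => defect (F z) ^ 2) z₀ := by fun_prop
    refine hcont.tendsto.eventually_lt_const ?_
    nlinarith [defect_pos hn0 (hF z₀)]
  obtain ⟨p, hp, N, hN, hpN⟩ := eventually_prod_iff.1 <|
    ((F.continuous.tendsto z₀).prodMap tendsto_id).eventually
      (eventually_forall_abs_le_add_smul_mem isOpen_relaxedSet hseg)
  have hball := eventually_closedBall_subset (hdefect.and (hp.and (Ω.isOpen.mem_nhds hz₀)))
  filter_upwards [hball.filter_mono nhdsWithin_le_nhds, self_mem_nhdsWithin] with r hr hr0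
  obtain ⟨b, hbS, hb, hbint⟩ := exists_bump_integral_sq_ge volume hr0 fun z hz => (hr hz).2.2
  obtain ⟨w, hmem, hw⟩ := hwave (waveAmplitude (F z₀) • b)
  refine ⟨w, hw.isPerturbation hF hη hmem
    ((tsupport_smul_subset_right (fun _ => waveAmplitude (F z₀)) b).trans hbS)
    (s := waveAmplitude (F z₀)) (fun z => ?_) ?_ hN fun z hz y hy => hpN (hr hz).2.1 hy⟩
  · rw [FunLike.coe_smul, Pi.smul_apply, smul_eq_mul, abs_mul, abs_of_pos hs]
    exact mul_le_of_le_one_right hs.le (hb z)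
  · have hV : 0 < volume.real (Metric.closedBall z₀ r) :=
      ENNReal.toReal_pos (Metric.measure_closedBall_pos volume z₀ hr0).ne'
        measure_closedBall_lt_top.ne
    have hle := gainConst_mul_setIntegral_le hn0 F fun z hz => (hr hz).1.le
    have hχ : ∫ z, (waveAmplitude (F z₀) • b) z ^ 2 = waveAmplitude (F z₀) ^ 2 * ∫ z, b z ^ 2 := by
      rw [← integral_const_mul]
      simp only [FunLike.coe_smul, Pi.smul_apply, smul_eq_mul, mul_pow]
    rw [he, hχ, one_pow, one_mul]
    have hpos : 0 < waveAmplitude (F z₀) ^ 2 *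
      (2⁻¹ ^ Module.finrank ℝ (SpaceTime n) * volume.real (Metric.closedBall z₀ r)) := by positivity
    have := mul_le_mul_of_nonneg_left hbint (sq_nonneg (waveAmplitude (F z₀)))
    linarith

end LocalPerturbation

section Covering

theorem exists_finset_pairwiseDisjoint_closedBall_integral_ge {α : Type*} [MetricSpace α]
    [SecondCountableTopology α] [HasBesicovitchCovering α] [MeasurableSpace α]
    [OpensMeasurableSpace α] (μ : Measure α) [SFinite μ] {U : Set α} (hU : IsOpen U) {f : α → ℝ}
    (hf : IntegrableOn f U μ) {p : α → ℝ → Prop} (hp : ∀ x ∈ U, ∀ᶠ r in 𝓝[>] 0, p x r) :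
    ∃ (s : Finset α) (r : α → ℝ), (s : Set α).PairwiseDisjoint (fun x => Metric.closedBall x (r x))
      ∧ (∀ x ∈ s, p x (r x))
      ∧ (∫ x in U, f x ∂μ) / 2 ≤ ∑ x ∈ s, ∫ y in Metric.closedBall x (r x), f y ∂μ := by
  have hsmall (x : α) (hx : x ∈ U) : ∀ᶠ r in 𝓝[>] (0 : ℝ), p x r ∧ Metric.closedBall x r ⊆ U :=
    (hp x hx).and ((eventually_closedBall_subset (hU.mem_nhds hx)).filter_mono nhdsWithin_le_nhds)
  obtain ⟨t, r, htc, -, htr, hcover, hdisj⟩ := Besicovitch.exists_disjoint_closedBall_covering_ae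
    μ (fun x => {r | p x r ∧ Metric.closedBall x r ⊆ U}) U
    (fun x hx δ hδ => ((hsmall x hx).and (Ioo_mem_nhdsGT hδ)).exists) 1 (fun _ _ => one_pos)
  have := htc.to_subtype
  have hball (x : t) : Metric.closedBall (x : α) (r x) ⊆ U := (htr x x.2).1.2
  have hsub : ⋃ x : t, Metric.closedBall (x : α) (r x) ⊆ U := Set.iUnion_subset hball
  have hsum := hasSum_integral_iUnion (μ := μ) (f := f)
    (fun x : t => (Metric.isClosed_closedBall (x := (x : α)) (ε := r x)).measurableSet)
    (fun x y hxy => hdisj x.2 y.2 (Subtype.coe_ne_coe.2 hxy)) (hf.mono_set hsub)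
  have hae : ⋃ x : t, Metric.closedBall (x : α) (r x) =ᵐ[μ] U :=
    hsub.eventuallyLE.antisymm (ae_le_set.2 (by rwa [Set.biUnion_eq_iUnion] at hcover))
  rw [setIntegral_congr_set hae] at hsum
  rcases le_or_gt (∫ x in U, f x ∂μ) 0 with hI | hI
  · exact ⟨∅, 0, by simp, by simp, by simpa using by linarith⟩
  · obtain ⟨s, hs⟩ := (hsum.eventually_const_lt (half_lt_self hI)).exists
    refine ⟨s.map (Function.Embedding.subtype (· ∈ t)), r, ?_, ?_, ?_⟩
    · exact hdisj.subset fun x hx => by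
        obtain ⟨y, -, rfl⟩ := Finset.mem_map.1 hx
        exact y.2
    · exact Finset.forall_mem_map.2 fun x _ => (htr x x.2).1.1
    · rw [Finset.sum_map]
      exact hs.le

variable {n : ℕ} {Ω : TopologicalSpace.Opens (SpaceTime n)} {F : 𝓓(Ω, State n)}

namespace IsPerturbation

theorem zero (hF : ∀ z, F z ∈ relaxedSet n) : IsPerturbation F ∅ 0 0 where
  mem_linearSolutions _ := zero_mem _
  eq_zero _ _ _ := rfl
  eventually_mem_relaxedSet := .of_forall fun _ z => by
    simpa only [Pi.zero_apply, FunLike.coe_zero, add_zero] using hF z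
  eventually_le_integral := .of_forall fun _ => integral_nonneg fun _ => sq_nonneg _
  tendsto_integral_inner G := by
    simp only [velocity_apply, Pi.zero_apply, FunLike.coe_zero, Prod.fst_zero, inner_zero_right,
      integral_zero, tendsto_const_nhds]

theorem add {S₁ S₂ : Set (SpaceTime n)} {g₁ g₂ : ℝ} {w₁ w₂ : ℕ → 𝓓(Ω, State n)}
    (h₁ : IsPerturbation F S₁ g₁ w₁) (h₂ : IsPerturbation F S₂ g₂ w₂) (hS : Disjoint S₁ S₂) :
    IsPerturbation F (S₁ ∪ S₂) (g₁ + g₂) (w₁ + w₂) := by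
  have hzero (k : ℕ) (z : SpaceTime n) : w₁ k z = 0 ∨ w₂ k z = 0 := by
    by_cases hz : z ∈ S₁
    · exact .inr (h₂.eq_zero k z (Set.disjoint_left.1 hS hz))
    · exact .inl (h₁.eq_zero k z hz)
  have hadd (k : ℕ) (z : SpaceTime n) : (w₁ + w₂) k z = w₁ k z + w₂ k z := rfl
  have hvelocity (k : ℕ) (z : SpaceTime n) :
      velocity ((w₁ + w₂) k) z = velocity (w₁ k) z + velocity (w₂ k) z := rfl
  refine ⟨fun k => add_mem (h₁.mem_linearSolutions k) (h₂.mem_linearSolutions k), ?_, ?_, ?_, ?_⟩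
  · intro k z hz
    rw [Set.mem_union, not_or] at hz
    rw [hadd, h₁.eq_zero k z hz.1, h₂.eq_zero k z hz.2, add_zero]
  · filter_upwards [h₁.eventually_mem_relaxedSet, h₂.eventually_mem_relaxedSet] with k hk₁ hk₂ z
    rcases hzero k z with h | h
    · rw [hadd, h, zero_add]
      exact hk₂ z
    · rw [hadd, h, add_zero]
      exact hk₁ z
  · filter_upwards [h₁.eventually_le_integral, h₂.eventually_le_integral] with k hk₁ hk₂
    refine (add_le_add hk₁ hk₂).trans_eq ?_
    rw [← integral_add (integrable_norm_sq _) (integrable_norm_sq _)]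
    refine integral_congr_ae (.of_forall fun z => ?_)
    simp only [hvelocity, velocity_apply]
    rcases hzero k z with h | h <;> simp [h]
  · intro G
    have h := (h₁.tendsto_integral_inner G).add (h₂.tendsto_integral_inner G)
    rw [add_zero] at h
    refine h.congr fun k => ?_
    simp only [hvelocity, inner_add_right]
    exact (integral_add (integrable_inner G _) (integrable_inner G _)).symm

theorem sum (hF : ∀ z, F z ∈ relaxedSet n) {ι : Type*} {s : Finset ι}
    {S : ι → Set (SpaceTime n)} {g : ι → ℝ} {w : ι → ℕ → 𝓓(Ω, State n)}
    (hS : (s : Set ι).PairwiseDisjoint S) (h : ∀ i ∈ s, IsPerturbation F (S i) (g i) (w i)) :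
    IsPerturbation F (⋃ i ∈ s, S i) (∑ i ∈ s, g i) (∑ i ∈ s, w i) := by
  classical
  induction s using Finset.induction_on with
  | empty => simpa only [Finset.notMem_empty, Set.iUnion_of_empty, Set.iUnion_empty,
      Finset.sum_empty] using zero hF
  | insert i s hi ih =>
    rw [Finset.forall_mem_insert] at h
    rw [Finset.coe_insert, Set.pairwiseDisjoint_insert_of_notMem (by exact_mod_cast hi)] at hS
    rw [Finset.set_biUnion_insert, Finset.sum_insert hi, Finset.sum_insert hi]
    exact h.1.add (ih hS.1 h.2) (Set.disjoint_iUnion₂_right.2 hS.2)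

end IsPerturbation

theorem integrableOn_defect_sq (hΩ : Bornology.IsBounded (Ω : Set (SpaceTime n)))
    (F : 𝓓(Ω, State n)) : IntegrableOn (fun z => defect (F z) ^ 2) Ω := by
  have hcont : Continuous fun z => defect (F z) ^ 2 := by
    have := F.continuous
    fun_prop
  exact (hcont.continuousOn.integrableOn_compact hΩ.isCompact_closure).mono_set subset_closure

theorem exists_isPerturbation (hn : 2 ≤ n) (hΩ : Bornology.IsBounded (Ω : Set (SpaceTime n)))
    (hF : ∀ z, F z ∈ relaxedSet n) :
    ∃ S w, IsPerturbation F S (gainConst n / 2 * ∫ z in Ω, defect (F z) ^ 2) w := by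
  obtain ⟨s, r, hdisj, hs, hint⟩ := exists_finset_pairwiseDisjoint_closedBall_integral_ge volume
    Ω.isOpen (integrableOn_defect_sq hΩ F)
    fun _ => eventually_exists_isPerturbation_closedBall hn hF
  choose! w hw using hs
  have hsum := IsPerturbation.sum hF hdisj hw
  refine ⟨_, _, { hsum with
    eventually_le_integral := hsum.eventually_le_integral.mono fun k hk => le_trans ?_ hk }⟩
  rw [← Finset.mul_sum, div_mul_eq_mul_div, mul_div_assoc]
  exact mul_le_mul_of_nonneg_left hint (gainConst_pos (by omega)).le

end Covering

section AlmostOrthogonal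

theorem exists_seq_forall_le {α : Type*} [Nonempty α] {p : ℕ → α → α → α → Prop}
    (h : ∀ k (s : Finset α) (a : α), ∃ b, ∀ x ∈ s, p k x a b) :
    ∃ f : ℕ → α, ∀ j k, j ≤ k → p k (f j) (f k) (f (k + 1)) := by
  classical
  choose next hnext using h
  let a₀ : α := Classical.arbitrary α
  let g : ℕ → Finset α × α := fun k =>
    Nat.rec ({a₀}, a₀) (fun k q => (insert (next k q.1 q.2) q.1, next k q.1 q.2)) k
  have hmem (j k : ℕ) (hjk : j ≤ k) : (g j).2 ∈ (g k).1 := by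
    induction k, hjk using Nat.le_induction with
    | base => cases j with
      | zero => exact Finset.mem_singleton_self _
      | succ j => exact Finset.mem_insert_self _ _
    | succ k _ ih => exact Finset.mem_insert_of_mem ih
  exact ⟨fun k => (g k).2, fun j k hjk => hnext k _ _ _ (hmem j k hjk)⟩

theorem cauchySeq_of_dist_sq_le {α : Type*} [PseudoMetricSpace α] {u : ℕ → α} {b : ℕ → ℝ}
    (hb : BddAbove (Set.range b)) (h : ∀ k m, k ≤ m → dist (u k) (u m) ^ 2 ≤ b m - b k) :
    CauchySeq u := by
  have hmono : Monotone b := fun k m hkm => sub_nonneg.1 ((sq_nonneg _).trans (h k m hkm))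
  have hlim : Tendsto (fun k => √((⨆ i, b i) - b k)) atTop (𝓝 0) := by
    simpa using ((tendsto_atTop_ciSup hmono hb).const_sub (⨆ i, b i)).sqrt
  refine cauchySeq_of_le_tendsto_0' _ (fun k m hkm => Real.le_sqrt_of_sq_le ?_) hlim
  exact (h k m hkm).trans (sub_le_sub_right (le_ciSup hb m) _)

theorem cauchySeq_of_almost_orthogonal {H : Type*} [NormedAddCommGroup H]
    [InnerProductSpace ℝ H] {u : ℕ → H} {B : ℝ} (hB : ∀ k, ‖u k‖ ≤ B) {ε : ℕ → ℝ}
    (hε : Summable ε) (h : ∀ j k, j ≤ k → |⟪u j, u (k + 1) - u k⟫| ≤ ε k) : CauchySeq u := by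
  let σ : ℕ → ℝ := fun k => ∑ i ∈ Finset.range k, ε i
  have hinner (k m : ℕ) (hkm : k ≤ m) : |⟪u k, u m - u k⟫| ≤ σ m - σ k := by
    rw [← Finset.sum_Ico_eq_sub _ hkm, ← Finset.sum_Ico_sub u hkm, inner_sum]
    exact (Finset.abs_sum_le_sum_abs _ _).trans
      (Finset.sum_le_sum fun i hi => h k i (Finset.mem_Ico.1 hi).1)
  refine cauchySeq_of_dist_sq_le (b := fun k => ‖u k‖ ^ 2 + 2 * σ k) ?_ fun k m hkm => ?_
  · refine ⟨B ^ 2 + 2 * ∑' i, ε i, ?_⟩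
    rintro _ ⟨k, rfl⟩
    have hσ : σ k ≤ ∑' i, ε i :=
      hε.sum_le_tsum _ fun i _ => (abs_nonneg _).trans (h i i le_rfl)
    have hu : ‖u k‖ ^ 2 ≤ B ^ 2 := pow_le_pow_left₀ (norm_nonneg _) (hB k) 2
    dsimp only
    linarith
  · have hexpand := norm_add_sq_real (u k) (u m - u k)
    rw [add_sub_cancel] at hexpand
    rw [dist_comm, dist_eq_norm]
    linarith [(abs_le.1 (hinner k m hkm)).1]

end AlmostOrthogonal

section SquareIntegrable

variable {E V : Type*} [NormedAddCommGroup E] [NormedSpace ℝ E]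
  {Ω Ω' : TopologicalSpace.Opens E} [MeasurableSpace E] [OpensMeasurableSpace E]
  [NormedAddCommGroup V] [InnerProductSpace ℝ V] (μ : Measure E)
  [IsFiniteMeasureOnCompacts μ]

theorem memLp_two (f : 𝓓(Ω, V)) : MemLp f 2 μ :=
  f.continuous.memLp_of_hasCompactSupport f.hasCompactSupport

/-- The class of a test function in `L²`. -/
def toL2 (f : 𝓓(Ω, V)) : Lp V 2 μ := (memLp_two μ f).toLp

theorem coeFn_toL2 (f : 𝓓(Ω, V)) : toL2 μ f =ᵐ[μ] f := (memLp_two μ f).coeFn_toLp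

theorem toL2_sub (f g : 𝓓(Ω, V)) : toL2 μ (f - g) = toL2 μ f - toL2 μ g :=
  (memLp_two μ f).toLp_sub (memLp_two μ g)

theorem inner_toL2 (f : 𝓓(Ω, V)) (g : 𝓓(Ω', V)) : ⟪toL2 μ f, toL2 μ g⟫ = ∫ x, ⟪f x, g x⟫ ∂μ := by
  rw [L2.inner_def]
  refine integral_congr_ae ?_
  filter_upwards [coeFn_toL2 μ f, coeFn_toL2 μ g] with x hf hg
  rw [hf, hg]

theorem norm_toL2_sq (f : 𝓓(Ω, V)) : ‖toL2 μ f‖ ^ 2 = ∫ x, ‖f x‖ ^ 2 ∂μ := by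
  rw [← real_inner_self_eq_norm_sq, inner_toL2]
  simp only [real_inner_self_eq_norm_sq]

theorem norm_toL2_sq_le (f : 𝓓(Ω, V)) (hΩ : μ Ω ≠ ⊤) (hf : ∀ x, ‖f x‖ ≤ 1) :
    ‖toL2 μ f‖ ^ 2 ≤ μ.real Ω := by
  have hzero (x : E) (hx : x ∉ Ω) : ‖f x‖ ^ 2 = 0 := by
    rw [eq_zero_of_notMem f hx, norm_zero, sq, mul_zero]
  rw [norm_toL2_sq, ← setIntegral_eq_integral_of_forall_compl_eq_zero hzero]
  calc ∫ x in Ω, ‖f x‖ ^ 2 ∂μ ≤ ∫ _ in Ω, (1 : ℝ) ∂μ :=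
        setIntegral_mono (integrable_norm_sq f).integrableOn (integrableOn_const hΩ)
          fun x => pow_le_one₀ (norm_nonneg _) (hf x)
    _ = μ.real Ω := by rw [setIntegral_const, smul_eq_mul, mul_one]

end SquareIntegrable

section Iteration

variable {n : ℕ} {Ω : TopologicalSpace.Opens (SpaceTime n)}

/-- A subsolution: a solution of the linear system whose values lie in the relaxed set. -/
structure IsSubsolution (F : 𝓓(Ω, State n)) : Prop where
  mem_linearSolutions : F ∈ linearSolutions Ω
  mem_relaxedSet : ∀ z, F z ∈ relaxedSet n

theorem isSubsolution_zero (hn : n ≠ 0) : IsSubsolution (0 : 𝓓(Ω, State n)) :=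
  ⟨zero_mem _, fun _ => zero_mem_relaxedSet hn⟩

theorem IsSubsolution.norm_velocity_lt_one (hn : n ≠ 0) {F : 𝓓(Ω, State n)}
    (hF : IsSubsolution F) (z : SpaceTime n) : ‖velocity F z‖ < 1 :=
  norm_fst_lt_one hn (hF.mem_relaxedSet z)

theorem IsSubsolution.exists_next (hn : 2 ≤ n)
    (hΩ : Bornology.IsBounded (Ω : Set (SpaceTime n))) {F : 𝓓(Ω, State n)} (hF : IsSubsolution F)
    (s : Finset 𝓓(Ω, Space n)) {ε : ℝ} (hε : 0 < ε) :
    ∃ F' : 𝓓(Ω, State n), IsSubsolution F' ∧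
      gainConst n / 2 * ∫ z in Ω, defect (F z) ^ 2
        ≤ ‖toL2 volume (velocity F') - toL2 volume (velocity F)‖ ^ 2 ∧
      ∀ G ∈ s, |⟪toL2 volume G, toL2 volume (velocity F') - toL2 volume (velocity F)⟫| ≤ ε := by
  obtain ⟨S, w, hw⟩ := exists_isPerturbation hn hΩ hF.mem_relaxedSet
  have hweak : ∀ᶠ k in atTop, ∀ G ∈ s, |∫ z, ⟪G z, velocity (w k) z⟫| ≤ ε := by
    refine (Finset.eventually_all s).2 fun G _ => ?_
    have h := (hw.tendsto_integral_inner G).abs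
    rw [abs_zero] at h
    exact h.eventually_le_const hε
  obtain ⟨k, hmem, hgain, hk⟩ :=
    (hw.eventually_mem_relaxedSet.and (hw.eventually_le_integral.and hweak)).exists
  refine ⟨F + w k, ⟨add_mem hF.mem_linearSolutions (hw.mem_linearSolutions k), hmem⟩, ?_⟩
  rw [← toL2_sub, map_add, add_sub_cancel_left, norm_toL2_sq]
  simp only [inner_toL2]
  exact ⟨hgain, hk⟩

theorem exists_subsolution_seq (hn : 2 ≤ n) (hΩ : Bornology.IsBounded (Ω : Set (SpaceTime n))) :
    ∃ F : ℕ → 𝓓(Ω, State n), (∀ k, IsSubsolution (F k)) ∧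
      (∀ k, gainConst n / 2 * ∫ z in Ω, defect (F k z) ^ 2
        ≤ ‖toL2 volume (velocity (F (k + 1))) - toL2 volume (velocity (F k))‖ ^ 2) ∧
      ∀ j k, j ≤ k → |⟪toL2 volume (velocity (F j)),
        toL2 volume (velocity (F (k + 1))) - toL2 volume (velocity (F k))⟫| ≤ (1 / 2) ^ k := by
  classical
  have : Nonempty {F : 𝓓(Ω, State n) // IsSubsolution F} := ⟨0, isSubsolution_zero (by omega)⟩
  obtain ⟨F, hF⟩ := exists_seq_forall_le (α := {F : 𝓓(Ω, State n) // IsSubsolution F})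
    (p := fun k G F F' => gainConst n / 2 * ∫ z in Ω, defect (F.1 z) ^ 2
        ≤ ‖toL2 volume (velocity F'.1) - toL2 volume (velocity F.1)‖ ^ 2 ∧
      |⟪toL2 volume (velocity G.1),
        toL2 volume (velocity F'.1) - toL2 volume (velocity F.1)⟫| ≤ (1 / 2) ^ k)
    fun k s F => by
      obtain ⟨F', hF', hgain, horth⟩ := F.2.exists_next hn hΩ (s.image fun G => velocity G.1)
        (by positivity : (0 : ℝ) < (1 / 2) ^ k)
      exact ⟨⟨F', hF'⟩, fun G hG => ⟨hgain, horth _ (Finset.mem_image_of_mem _ hG)⟩⟩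
  exact ⟨fun k => (F k).1, fun k => (F k).2, fun k => (hF k k le_rfl).1,
    fun j k hjk => (hF j k hjk).2⟩

/-- The velocity field `v` is the almost everywhere limit of the velocities of the subsolutions
`F k`, whose energy defects disappear in `L²(Ω)`. -/
structure IsConvexIntegrationLimit (F : ℕ → 𝓓(Ω, State n)) (v : SpaceTime n → Space n) :
    Prop where
  isSubsolution : ∀ k, IsSubsolution (F k)
  tendsto_velocity : ∀ᵐ z, Tendsto (fun k => velocity (F k) z) atTop (𝓝 (v z))
  tendsto_integral_defect_sq : Tendsto (fun k => ∫ z in Ω, defect (F k z) ^ 2) atTop (𝓝 0)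

theorem exists_isConvexIntegrationLimit (hn : 2 ≤ n)
    (hΩ : Bornology.IsBounded (Ω : Set (SpaceTime n))) :
    ∃ (F : ℕ → 𝓓(Ω, State n)) (v : SpaceTime n → Space n), IsConvexIntegrationLimit F v := by
  have hn0 : n ≠ 0 := by omega
  obtain ⟨F, hF, hgain, horth⟩ := exists_subsolution_seq hn hΩ
  have hbound (k : ℕ) : ‖toL2 volume (velocity (F k))‖ ≤ √(volume.real (Ω : Set (SpaceTime n))) :=
    Real.le_sqrt_of_sq_le <| norm_toL2_sq_le volume _ hΩ.measure_lt_top.ne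
      fun z => ((hF k).norm_velocity_lt_one hn0 z).le
  obtain ⟨v, hv⟩ := cauchySeq_tendsto_of_complete
    (cauchySeq_of_almost_orthogonal hbound summable_geometric_two horth)
  have hdefect : Tendsto (fun k => ∫ z in Ω, defect (F k z) ^ 2) atTop (𝓝 0) := by
    have hstep := ((hv.comp (tendsto_add_atTop_nat 1)).sub hv).norm.pow 2
    rw [sub_self, norm_zero, zero_pow two_ne_zero] at hstep
    have hlim := hstep.div_const (gainConst n / 2)
    rw [zero_div] at hlim
    refine squeeze_zero (fun k => integral_nonneg fun z => sq_nonneg _) (fun k => ?_) hlim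
    rw [le_div_iff₀' (half_pos (gainConst_pos hn0))]
    exact hgain k
  obtain ⟨φ, hφ, hae⟩ := (tendstoInMeasure_of_tendsto_Lp hv).exists_seq_tendsto_ae
  refine ⟨fun k => F (φ k), v, fun k => hF _, ?_, hdefect.comp hφ.tendsto_atTop⟩
  have heq : ∀ᵐ z, ∀ k, toL2 volume (velocity (F k)) z = velocity (F k) z :=
    ae_all_iff.2 fun k => coeFn_toL2 volume (velocity (F k))
  filter_upwards [hae, heq] with z hz h
  simpa only [h] using hz

theorem ae_eq_zero_of_tendsto_integral_zero {α : Type*} [MeasurableSpace α] {μ : Measure α}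
    {f : ℕ → α → ℝ} {g : α → ℝ} (hf : ∀ k, Integrable (f k) μ) (hf0 : ∀ k x, 0 ≤ f k x)
    (hlim : ∀ᵐ x ∂μ, Tendsto (fun k => f k x) atTop (𝓝 (g x)))
    (h : Tendsto (fun k => ∫ x, f k x ∂μ) atTop (𝓝 0)) : g =ᵐ[μ] 0 := by
  have hmeas (k : ℕ) : AEMeasurable (fun x => ENNReal.ofReal (f k x)) μ :=
    (hf k).aemeasurable.ennreal_ofReal
  have hlim' : ∀ᵐ x ∂μ, Tendsto (fun k => ENNReal.ofReal (f k x)) atTop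
      (𝓝 (ENNReal.ofReal (g x))) := hlim.mono fun x hx => ENNReal.tendsto_ofReal hx
  have hzero : ∫⁻ x, ENNReal.ofReal (g x) ∂μ ≤ 0 := calc
    ∫⁻ x, ENNReal.ofReal (g x) ∂μ
        = ∫⁻ x, liminf (fun k => ENNReal.ofReal (f k x)) atTop ∂μ :=
      lintegral_congr_ae (hlim'.mono fun x hx => hx.liminf_eq.symm)
    _ ≤ liminf (fun k => ∫⁻ x, ENNReal.ofReal (f k x) ∂μ) atTop := lintegral_liminf_le' hmeas
    _ = liminf (fun k => ENNReal.ofReal (∫ x, f k x ∂μ)) atTop := by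
      simp only [ofReal_integral_eq_lintegral_ofReal (hf _) (.of_forall (hf0 _))]
    _ = 0 := by simpa using (ENNReal.tendsto_ofReal h).liminf_eq
  have hg := (lintegral_eq_zero_iff' (aemeasurable_of_tendsto_metrizable_ae' hmeas hlim')).1
    (nonpos_iff_eq_zero.1 hzero)
  filter_upwards [hg, hlim] with x hgx hx
  exact (ENNReal.ofReal_eq_zero.1 hgx).antisymm (ge_of_tendsto' hx fun k => hf0 k x)

namespace IsConvexIntegrationLimit

variable {F : ℕ → 𝓓(Ω, State n)} {v : SpaceTime n → Space n}

theorem ae_norm_eq_one (h : IsConvexIntegrationLimit F v)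
    (hΩ : Bornology.IsBounded (Ω : Set (SpaceTime n))) : ∀ᵐ z, z ∈ Ω → ‖v z‖ = 1 := by
  have hzero := ae_eq_zero_of_tendsto_integral_zero (fun k => integrableOn_defect_sq hΩ (F k))
    (fun k z => sq_nonneg _) (g := fun z => (1 - ‖v z‖ ^ 2) ^ 2)
    ((ae_restrict_of_ae h.tendsto_velocity).mono fun z hz => ((hz.norm.pow 2).const_sub 1).pow 2)
    h.tendsto_integral_defect_sq
  refine ((ae_restrict_iff' Ω.isOpen.measurableSet).1 hzero).mono fun z hz hzΩ => ?_
  have hsq : ‖v z‖ ^ 2 = 1 := (sub_eq_zero.1 (eq_zero_of_pow_eq_zero (hz hzΩ))).symm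
  exact (pow_eq_one_iff_of_nonneg (norm_nonneg _) two_ne_zero).1 hsq

theorem ae_eq_zero_of_notMem (h : IsConvexIntegrationLimit F v) : ∀ᵐ z, z ∉ Ω → v z = 0 := by
  filter_upwards [h.tendsto_velocity] with z hz hzΩ
  refine tendsto_nhds_unique hz ?_
  simp only [eq_zero_of_notMem (velocity (F _)) hzΩ, tendsto_const_nhds]

theorem ae_norm_le_one (h : IsConvexIntegrationLimit F v) (hn : n ≠ 0) : ∀ᵐ z, ‖v z‖ ≤ 1 :=
  h.tendsto_velocity.mono fun z hz =>
    le_of_tendsto' hz.norm fun k => ((h.isSubsolution k).norm_velocity_lt_one hn z).le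

theorem memLp_top (h : IsConvexIntegrationLimit F v) (hn : n ≠ 0) : MemLp v ⊤ volume :=
  memLp_top_of_bound (aestronglyMeasurable_of_tendsto_ae atTop
    (fun k => (velocity (F k)).continuous.aestronglyMeasurable) h.tendsto_velocity) 1
    (h.ae_norm_le_one hn)

end IsConvexIntegrationLimit

end Iteration

section EulerFlux

variable {n : ℕ}

/-- The pressure `-|v|² / n`, the one for which the momentum flux `v ⊗ v + p I` has trace zero. -/
def pressure (v : Space n) : ℝ := -(‖v‖ ^ 2 / n)

/-- The space-time flux `(vᵢ v + q eᵢ, vᵢ)` of the `i`-th momentum in the Euler equations with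
velocity `v` and pressure `q`. -/
def eulerFlux (i : Fin n) (v : Space n) (q : ℝ) : SpaceTime n :=
  (v i • v + q • EuclideanSpace.single i 1, v i)

/-- The spatial part of the difference between the momentum fluxes of the Euler equations and of
the linear system; their temporal parts agree. -/
def eulerError (i : Fin n) (P : State n) : Space n :=
  (eulerFlux i P.1 (pressure P.1) - momentumFlux i P).1

theorem momentumFlux_eq_sub (i : Fin n) (P : State n) :
    momentumFlux i P = eulerFlux i P.1 (pressure P.1) - (eulerError i P, 0) :=
  Prod.ext (sub_sub_cancel _ _).symm (sub_zero _).symm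

theorem eulerError_apply (i j : Fin n) (P : State n) :
    eulerError i P j = P.1 i * P.1 j + (if i = j then pressure P.1 else 0)
      - (P.2 : Fin n → Fin n → ℝ) i j := by
  simp [eulerError, eulerFlux, momentumFlux, eq_comm]

theorem eulerError_apply_comm (i j : Fin n) (P : State n) :
    eulerError i P j = eulerError j P i := by
  simp only [eulerError_apply, mul_comm (P.1 i), eq_comm (a := i), P.2.2.1 i j]

theorem eulerError_apply_eq_sub_stress (i j : Fin n) (P : State n) :
    eulerError i P j = (if i = j then defect P / n else 0) - stress P i j := by
  simp only [eulerError_apply, stress, pressure, defect, Matrix.sub_apply, Matrix.add_apply,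
    Matrix.smul_apply, Matrix.one_apply, Matrix.of_apply, Matrix.vecMulVec_apply, smul_eq_mul]
  split_ifs <;> ring

@[fun_prop]
theorem contDiff_pressure : ContDiff ℝ ∞ (pressure (n := n)) :=
  ((contDiff_norm_sq ℝ).div_const _).neg

theorem pressure_zero : pressure (0 : Space n) = 0 := by
  simp [pressure]

theorem abs_pressure_le_one {v : Space n} (hv : ‖v‖ ≤ 1) : |pressure v| ≤ 1 := by
  rw [pressure, abs_neg, abs_of_nonneg (by positivity)]
  rcases n.eq_zero_or_pos with rfl | hn
  · simp
  · exact div_le_one_of_le₀ ((pow_le_one₀ (norm_nonneg v) hv).trans (Nat.one_le_cast.2 hn))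
      n.cast_nonneg

theorem contDiff_eulerError (i : Fin n) : ContDiff ℝ ∞ (eulerError i) := by
  unfold eulerError eulerFlux
  fun_prop

theorem eulerError_zero (i : Fin n) : eulerError i 0 = 0 := by
  simp [eulerError, eulerFlux, pressure_zero]

theorem norm_eulerFlux_le_two (i : Fin n) {v : Space n} (hv : ‖v‖ ≤ 1) {q : ℝ} (hq : |q| ≤ 1) :
    ‖eulerFlux i v q‖ ≤ 2 := by
  have hvi : ‖v i‖ ≤ 1 := (PiLp.norm_apply_le v i).trans hv
  refine max_le ((norm_add_le _ _).trans ?_) (hvi.trans one_le_two)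
  rw [norm_smul, norm_smul, PiLp.norm_single, norm_one, mul_one]
  exact (add_le_add (mul_le_one₀ hvi (norm_nonneg _) hv) hq).trans_eq one_add_one_eq_two

theorem abs_eulerError_apply_le {P : State n} (hP : P ∈ relaxedSet n) (i j : Fin n) :
    |eulerError i P j| ≤ defect P := by
  have hn : n ≠ 0 := i.pos.ne'
  have hn1 : (1 : ℝ) ≤ n := Nat.one_le_cast.2 i.pos
  have hstress : |stress P i j| ≤ defect P :=
    (abs_apply_le_trace hP.posSemidef i j).trans_eq (trace_stress hn P)
  have hdefect : 0 ≤ defect P := (defect_pos hn hP).le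
  rw [eulerError_apply_eq_sub_stress]
  split_ifs with h
  · subst h
    have hdiag : 0 ≤ stress P i i := hP.posSemidef.diag_nonneg
    exact abs_sub_le_of_nonneg_of_le (div_nonneg hdefect (by positivity))
      (div_le_self hdefect hn1) hdiag (le_of_abs_le hstress)
  · rwa [zero_sub, abs_neg]

theorem norm_eulerError_sq_le {P : State n} (hP : P ∈ relaxedSet n) (i : Fin n) :
    ‖eulerError i P‖ ^ 2 ≤ n * defect P ^ 2 := by
  rw [EuclideanSpace.real_norm_sq_eq]
  refine (Finset.sum_le_card_nsmul _ _ (defect P ^ 2) fun j _ => ?_).trans_eq (by simp)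
  exact sq_le_sq' (abs_le.1 (abs_eulerError_apply_le hP i j)).1
    (abs_le.1 (abs_eulerError_apply_le hP i j)).2

theorem norm_momentumFlux_le {P : State n} (hP : P ∈ relaxedSet n) (i : Fin n) :
    ‖momentumFlux i P‖ ≤ 2 + √n := by
  have hn : n ≠ 0 := i.pos.ne'
  have hv : ‖P.1‖ ≤ 1 := (norm_fst_lt_one hn hP).le
  have hdefect : defect P ^ 2 ≤ 1 :=
    pow_le_one₀ (defect_pos hn hP).le (sub_le_self 1 (sq_nonneg ‖P.1‖))
  have herror : ‖eulerError i P‖ ≤ √n := Real.le_sqrt_of_sq_le <|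
    (norm_eulerError_sq_le hP i).trans (mul_le_of_le_one_right n.cast_nonneg hdefect)
  have hnorm : ‖((eulerError i P, 0) : SpaceTime n)‖ = ‖eulerError i P‖ := by simp
  rw [momentumFlux_eq_sub]
  exact (norm_sub_le _ _).trans
    (add_le_add (norm_eulerFlux_le_two i hv (abs_pressure_le_one hv)) (hnorm.trans_le herror))

end EulerFlux

section Force

variable {n : ℕ} {Ω : TopologicalSpace.Opens (SpaceTime n)}

/-- The pressure of a subsolution. -/
def pressureField (F : 𝓓(Ω, State n)) : 𝓓(Ω, ℝ) :=
  smoothComp pressure contDiff_pressure pressure_zero (velocity F)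

/-- The flux error `eulerError j` along `F`. -/
def errorField (j : Fin n) (F : 𝓓(Ω, State n)) : 𝓓(Ω, Space n) :=
  smoothComp (eulerError j) (contDiff_eulerError j) (eulerError_zero j) F

/-- The force with which the velocity and the pressure of a solution of the linear system satisfy
the Euler equations: the divergence of the flux error, which is symmetric. -/
def force (F : 𝓓(Ω, State n)) : 𝓓(Ω, Space n) := ∑ j, ∂_{spaceDir j} (errorField j F)

theorem stDiv_postcompCLM_inl (G : 𝓓(Ω, Space n)) (z : SpaceTime n) :
    stDiv (TestFunction.postcompCLM (ContinuousLinearMap.inl ℝ (Space n) ℝ) G) z = divx G z := by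
  rw [stDiv_apply]
  exact (add_eq_left.2 (by simp [dt])).trans rfl

theorem force_apply (F : 𝓓(Ω, State n)) (z : SpaceTime n) (i : Fin n) :
    force F z i = divx (errorField i F) z := by
  rw [force, FunLike.coe_sum, Finset.sum_apply, WithLp.ofLp_sum, Finset.sum_apply, divx]
  refine Finset.sum_congr rfl fun j _ => ?_
  have hcomp : (fun y => errorField i F y j) = fun y => TestFunction.postcompCLM
      (EuclideanSpace.proj i : Space n →L[ℝ] ℝ) (errorField j F) y :=
    funext fun y => eulerError_apply_comm i j (F y)
  rw [hcomp]
  exact .symm <| (lineDerivOp_apply _ _ z).symm.trans <| DFunLike.congr_fun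
    (lineDerivOp_postcompCLM (EuclideanSpace.proj i : Space n →L[ℝ] ℝ) (errorField j F) _) z

theorem isClassicalSolution_of_mem_linearSolutions {F : 𝓓(Ω, State n)}
    (hF : F ∈ linearSolutions Ω) :
    IsClassicalSolution (velocity F) (pressureField F) (force F) where
  incompressible z := by
    rw [← stDiv_postcompCLM_inl]
    exact DFunLike.congr_fun (mem_linearSolutions.1 hF).1 z
  momentum z i := by
    let E : 𝓓(Ω, SpaceTime n) := TestFunction.postcompCLM (momentumFlux i) F
      + TestFunction.postcompCLM (ContinuousLinearMap.inl ℝ (Space n) ℝ) (errorField i F)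
    have hE (y : SpaceTime n) : E y = eulerFlux i (velocity F y) (pressureField F y) :=
      add_eq_of_eq_sub (momentumFlux_eq_sub i (F y))
    have hdiv : stDiv E z = force F z i := by
      rw [force_apply, ← stDiv_postcompCLM_inl, map_add]
      exact add_eq_right.2 (DFunLike.congr_fun ((mem_linearSolutions.1 hF).2 i) z)
    have hdiff (j : Fin n) : dx j (fun y => (E y).1 j) z
        = dx j (fun y => velocity F y i * velocity F y j) z
          + if i = j then dx j (pressureField F) z else 0 := by
      have hsmooth {G : Type} [NormedAddCommGroup G] [NormedSpace ℝ G] (f : 𝓓(Ω, G)) :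
          DifferentiableAt ℝ f z := f.contDiff.differentiable (by simp) z
      have hv := hsmooth (velocity F)
      have hp := hsmooth (pressureField F)
      have hmul : DifferentiableAt ℝ (fun y => velocity F y i * velocity F y j) z := by fun_prop
      simp only [hE, eulerFlux, dx]
      split_ifs with hij
      · subst hij
        simp [fderiv_fun_add hmul hp]
      · simp [hij]
    rw [← hdiv, stDiv_apply]
    simp only [hdiff, Finset.sum_add_distrib, Finset.sum_ite_eq, Finset.mem_univ, if_true]
    simp only [hE, eulerFlux]
    ring

end Force

section NegativeSobolev

variable {n : ℕ} {Ω : TopologicalSpace.Opens (SpaceTime n)}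

theorem norm_toL2_lineDerivOp_sq_le (φ : 𝓓((⊤ : TopologicalSpace.Opens (SpaceTime n)), Space n))
    (j : Fin n) : ‖toL2 volume (∂_{spaceDir j} φ)‖ ^ 2 ≤ h1NormSq φ := by
  have hdx (k : Fin n) (z : SpaceTime n) : dx k φ z = (∂_{spaceDir k} φ) z :=
    (lineDerivOp_apply φ _ z).symm
  have hdt (z : SpaceTime n) : dt φ z = (∂_{((0, 1) : SpaceTime n)} φ) z :=
    (lineDerivOp_apply φ _ z).symm
  rw [norm_toL2_sq, h1NormSq]
  simp only [hdx, hdt]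
  refine integral_mono (integrable_norm_sq _) (((integrable_norm_sq φ).add
    (integrable_norm_sq _)).add (integrable_finsetSum _ fun k _ => integrable_norm_sq _))
    fun z => ?_
  exact (Finset.single_le_sum (f := fun k => ‖(∂_{spaceDir k} φ) z‖ ^ 2)
    (fun k _ => sq_nonneg _) (Finset.mem_univ j)).trans
    (le_add_of_nonneg_left (add_nonneg (sq_nonneg _) (sq_nonneg _)))

theorem hNegOneNorm_sum_lineDerivOp_le (D : Fin n → 𝓓(Ω, Space n)) :
    hNegOneNorm (∑ j, ∂_{spaceDir j} (D j) : 𝓓(Ω, Space n))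
      ≤ ENNReal.ofReal (∑ j, ‖toL2 volume (D j)‖) := by
  refine iSup₂_le fun φ hφ => ENNReal.ofReal_le_ofReal ?_
  have hparts : ∫ z, ∑ i, (∑ j, ∂_{spaceDir j} (D j) : 𝓓(Ω, Space n)) z i * φ z i
      = ∑ j, -⟪toL2 volume (D j), toL2 volume (∂_{spaceDir j} φ)⟫ := by
    simp only [inner_toL2, integral_inner_lineDerivOp, neg_neg]
    rw [← integral_finsetSum _ fun j _ => integrable_inner _ _]
    refine integral_congr_ae (.of_forall fun z => ?_)
    simp only [← sum_inner, FunLike.coe_sum, Finset.sum_apply]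
    simp only [PiLp.inner_apply, RCLike.inner_apply, conj_trivial, mul_comm]
  rw [hparts]
  refine (Finset.abs_sum_le_sum_abs _ _).trans (Finset.sum_le_sum fun j _ => ?_)
  rw [abs_neg]
  refine (abs_real_inner_le_norm _ _).trans (mul_le_of_le_one_right (norm_nonneg _) ?_)
  exact (sq_le_one_iff₀ (norm_nonneg _)).1 ((norm_toL2_lineDerivOp_sq_le φ j).trans hφ)

theorem norm_toL2_errorField_le (hΩ : Bornology.IsBounded (Ω : Set (SpaceTime n)))
    {F : 𝓓(Ω, State n)} (hF : ∀ z, F z ∈ relaxedSet n) (j : Fin n) :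
    ‖toL2 volume (errorField j F)‖ ≤ √(n * ∫ z in Ω, defect (F z) ^ 2) := by
  refine Real.le_sqrt_of_sq_le ?_
  have hzero (z : SpaceTime n) (hz : z ∉ Ω) : ‖errorField j F z‖ ^ 2 = 0 := by
    rw [eq_zero_of_notMem _ hz, norm_zero, sq, mul_zero]
  rw [norm_toL2_sq, ← setIntegral_eq_integral_of_forall_compl_eq_zero hzero, ← integral_const_mul]
  exact setIntegral_mono (integrable_norm_sq _).integrableOn
    ((integrableOn_defect_sq hΩ F).const_mul _) fun z => norm_eulerError_sq_le (hF z) j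

theorem IsConvexIntegrationLimit.tendsto_hNegOneNorm_force
    {F : ℕ → 𝓓(Ω, State n)} {v : SpaceTime n → Space n} (h : IsConvexIntegrationLimit F v)
    (hΩ : Bornology.IsBounded (Ω : Set (SpaceTime n))) :
    Tendsto (fun k => hNegOneNorm (force (F k))) atTop (𝓝 0) := by
  have hlim : Tendsto (fun k => ∑ _j : Fin n, √(n * ∫ z in Ω, defect (F k z) ^ 2)) atTop (𝓝 0) := by
    simpa using tendsto_finsetSum Finset.univ fun (_ : Fin n) _ =>
      (h.tendsto_integral_defect_sq.const_mul (n : ℝ)).sqrt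
  have hlim' := ENNReal.tendsto_ofReal hlim
  rw [ENNReal.ofReal_zero] at hlim'
  refine tendsto_of_tendsto_of_tendsto_of_le_of_le tendsto_const_nhds hlim'
    (fun k => zero_le) fun k => ?_
  exact (hNegOneNorm_sum_lineDerivOp_le _).trans (ENNReal.ofReal_le_ofReal <|
    Finset.sum_le_sum fun j _ =>
      norm_toL2_errorField_le hΩ (h.isSubsolution k).mem_relaxedSet j)

end NegativeSobolev

section WeakLimit

variable {n : ℕ} {Ω : TopologicalSpace.Opens (SpaceTime n)}

/-- Bounded vector fields on space-time which are divergence free in the sense of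
distributions. -/
structure IsWeaklyDivFree (X : SpaceTime n → SpaceTime n) : Prop where
  memLp_top : MemLp X ⊤ volume
  integral_eq_zero : ∀ ψ : 𝓓((⊤ : TopologicalSpace.Opens (SpaceTime n)), ℝ),
    ∫ z, fderiv ℝ ψ z (X z) = 0

theorem integrable_fderiv (ψ : 𝓓(Ω, ℝ)) : Integrable (fderiv ℝ ψ) :=
  (ψ.contDiff.continuous_fderiv (by simp)).integrable_of_hasCompactSupport
    (ψ.hasCompactSupport.fderiv ℝ)

theorem integrable_fderiv_apply (ψ : 𝓓(Ω, ℝ)) {X : SpaceTime n → SpaceTime n}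
    (hX : MemLp X ⊤ volume) : Integrable fun z => fderiv ℝ ψ z (X z) := by
  have hψ := memLp_one_iff_integrable.2 (integrable_fderiv ψ)
  refine memLp_one_iff_integrable.1 (hψ.of_bilin (fun L x => L x) 1 hX
    (isBoundedBilinearMap_apply.continuous.comp_aestronglyMeasurable₂ hψ.aestronglyMeasurable
      hX.aestronglyMeasurable) (.of_forall fun z => ?_))
  rw [one_mul]
  exact (fderiv ℝ ψ z).le_opNNNorm (X z)

theorem isWeaklyDivFree_of_tendsto {X : ℕ → 𝓓(Ω, SpaceTime n)} {Y : SpaceTime n → SpaceTime n}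
    {C : ℝ} (hdiv : ∀ k, stDiv (X k) = 0) (hC : ∀ k z, ‖X k z‖ ≤ C)
    (hlim : ∀ᵐ z, Tendsto (fun k => X k z) atTop (𝓝 (Y z))) : IsWeaklyDivFree Y where
  memLp_top := memLp_top_of_bound (aestronglyMeasurable_of_tendsto_ae atTop
    (fun k => (X k).continuous.aestronglyMeasurable) hlim) C
    (hlim.mono fun z hz => le_of_tendsto' hz.norm fun k => hC k z)
  integral_eq_zero ψ := by
    have hzero (k : ℕ) : ∫ z, fderiv ℝ ψ z (X k z) = 0 := by
      rw [integral_fderiv_eq_neg_integral_mul_stDiv, hdiv]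
      simp
    have hcont : Continuous (fderiv ℝ ψ) := ψ.contDiff.continuous_fderiv (by simp)
    have h := tendsto_integral_of_dominated_convergence (fun z => ‖fderiv ℝ ψ z‖ * C)
      (fun k => (hcont.clm_apply (X k).continuous).aestronglyMeasurable)
      ((integrable_fderiv ψ).norm.mul_const C)
      (fun k => .of_forall fun z => (fderiv ℝ ψ z).le_opNorm_of_le (hC k z))
      (hlim.mono fun z hz => ((fderiv ℝ ψ z).continuous.tendsto _).comp hz)
    simp only [hzero] at h
    exact tendsto_nhds_unique h tendsto_const_nhds

theorem isWeakSolution_of_isWeaklyDivFree {v : SpaceTime n → Space n} {p : SpaceTime n → ℝ}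
    (hv : MemLp v ⊤ volume) (hp : MemLp p ⊤ volume) (hmass : IsWeaklyDivFree fun z => (v z, 0))
    (hmom : ∀ i, IsWeaklyDivFree fun z => eulerFlux i (v z) (p z)) :
    IsWeakSolution v p (fun _ => 0) where
  aestronglyMeasurable := hv.aestronglyMeasurable
  sq_locallyIntegrable := by
    have h := hv.norm.mul' hv.norm (r := ⊤)
    simpa only [sq] using h.locallyIntegrable le_top
  pressure_locallyIntegrable := hp.locallyIntegrable le_top
  force_locallyIntegrable := locallyIntegrable_const _
  momentum φ := by
    let comp (i : Fin n) := TestFunction.postcompCLM (EuclideanSpace.proj i : Space n →L[ℝ] ℝ) φ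
    have hsum : ∫ z, ∑ i, fderiv ℝ (comp i) z (eulerFlux i (v z) (p z)) = 0 := by
      rw [integral_finsetSum _ fun i _ => integrable_fderiv_apply _ (hmom i).memLp_top]
      exact Finset.sum_eq_zero fun i _ => (hmom i).integral_eq_zero _
    rw [← hsum]
    congr 1 with z
    have hcomp (i : Fin n) : (comp i : SpaceTime n → ℝ) = fun y => φ y i := rfl
    simp only [hcomp, fderiv_apply_eq_sum_dx_add_dt, eulerFlux, divx]
    simp only [Finset.mul_sum, PiLp.zero_apply, zero_mul, Finset.sum_const_zero, add_zero,
      PiLp.add_apply, PiLp.smul_apply, smul_eq_mul, PiLp.single_apply, mul_ite, mul_one, mul_zero,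
      add_mul, ite_mul, Finset.sum_add_distrib, Finset.sum_ite_eq', Finset.mem_univ, if_true]
    ring
  incompressible ψ := by
    rw [← hmass.integral_eq_zero ψ]
    simp only [fderiv_apply_eq_sum_dx_add_dt, zero_mul, add_zero, smul_eq_mul]

end WeakLimit

section DominatedConvergence

variable {α V : Type*} [MeasurableSpace α] {μ : Measure α} [NormedAddCommGroup V]

theorem tendsto_eLpNorm_zero_of_dominated {q : ℝ≥0∞} (hq : q ≠ ⊤) {g : ℕ → α → V} {b : α → ℝ}
    (hb : MemLp b q μ) (hg : ∀ k, AEStronglyMeasurable (g k) μ)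
    (hle : ∀ k, ∀ᵐ x ∂μ, ‖g k x‖ ≤ b x)
    (hlim : ∀ᵐ x ∂μ, Tendsto (fun k => g k x) atTop (𝓝 0)) :
    Tendsto (fun k => eLpNorm (g k) q μ) atTop (𝓝 0) := by
  rcases eq_or_ne q 0 with rfl | hq0
  · simp
  have hpos : 0 < q.toReal := ENNReal.toReal_pos hq0 hq
  have hpow {r : ℝ} (hr : 0 < r) : Tendsto (fun x : ℝ≥0∞ => x ^ r) (𝓝 0) (𝓝 0) := by
    simpa [ENNReal.zero_rpow_of_pos hr] using (ENNReal.continuous_rpow_const (y := r)).tendsto 0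
  have hint : Tendsto (fun k => ∫⁻ x, ‖g k x‖ₑ ^ q.toReal ∂μ) atTop (𝓝 (∫⁻ _, 0 ∂μ)) := by
    refine tendsto_lintegral_of_dominated_convergence' (fun x => ‖b x‖ₑ ^ q.toReal)
      (fun k => (hg k).enorm.pow_const _)
      (fun k => (hle k).mono fun x hx => ?_) ?_ (hlim.mono fun x hx => ?_)
    · exact ENNReal.rpow_le_rpow (enorm_le_iff_norm_le.2 (hx.trans (le_abs_self _))) hpos.le
    · exact (lintegral_rpow_enorm_lt_top_of_eLpNorm_lt_top hq0 hq hb.eLpNorm_lt_top).ne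
    · exact (hpow hpos).comp (enorm_zero (E := V) ▸ hx.enorm)
  rw [lintegral_zero] at hint
  simp only [eLpNorm_eq_lintegral_rpow_enorm_toReal hq0 hq]
  exact (hpow (one_div_pos.2 hpos)).comp hint

end DominatedConvergence

section TestFunctionLp

variable {E V : Type*} [NormedAddCommGroup E] [NormedSpace ℝ E] [MeasurableSpace E]
  [OpensMeasurableSpace E] [NormedAddCommGroup V] [NormedSpace ℝ V] [SecondCountableTopology E]
  {Ω : TopologicalSpace.Opens E} {μ : Measure E}

theorem tendsto_eLpNorm_sub_zero (hΩ : μ Ω ≠ ⊤) {f : ℕ → 𝓓(Ω, V)} {g : E → V} {C : ℝ}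
    (hC : ∀ k x, ‖f k x‖ ≤ C) (hlim : ∀ᵐ x ∂μ, Tendsto (fun k => f k x) atTop (𝓝 (g x)))
    {q : ℝ≥0∞} (hq : q ≠ ⊤) :
    Tendsto (fun k => eLpNorm (fun x => f k x - g x) q μ) atTop (𝓝 0) := by
  have hmeas (k : ℕ) : AEStronglyMeasurable (f k) μ := (f k).continuous.aestronglyMeasurable
  have hbound (k : ℕ) (x : E) : ‖f k x‖ ≤ (Ω : Set E).indicator (fun _ => C) x := by
    by_cases hx : x ∈ Ω
    · rw [Set.indicator_of_mem (SetLike.mem_coe.2 hx)]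
      exact hC k x
    · rw [eq_zero_of_notMem _ hx, norm_zero, Set.indicator_of_notMem hx]
  have hb : MemLp ((Ω : Set E).indicator fun _ => C) q μ :=
    memLp_indicator_const q Ω.isOpen.measurableSet C (.inr hΩ)
  refine tendsto_eLpNorm_zero_of_dominated hq (hb.add hb)
    (fun k => (hmeas k).sub (aestronglyMeasurable_of_tendsto_ae atTop hmeas hlim))
    (fun k => hlim.mono fun x hx => (norm_sub_le _ _).trans ?_)
    (hlim.mono fun x hx => sub_self (g x) ▸ hx.sub_const (g x))
  exact add_le_add (hbound k x) (le_of_tendsto' hx.norm fun k => hbound k x)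

end TestFunctionLp

section EulerLimit

variable {n : ℕ} {Ω : TopologicalSpace.Opens (SpaceTime n)} {F : ℕ → 𝓓(Ω, State n)}
  {v : SpaceTime n → Space n}

namespace IsConvexIntegrationLimit

theorem ae_tendsto_eulerError (h : IsConvexIntegrationLimit F v)
    (hΩ : Bornology.IsBounded (Ω : Set (SpaceTime n))) (i : Fin n) :
    ∀ᵐ z, Tendsto (fun k => eulerError i (F k z)) atTop (𝓝 0) := by
  filter_upwards [h.tendsto_velocity, h.ae_norm_eq_one hΩ] with z hz hone
  by_cases hzΩ : z ∈ Ω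
  · have hdefect : Tendsto (fun k => defect (F k z)) atTop (𝓝 0) := by
      have hlim := (hz.norm.pow 2).const_sub 1
      rwa [hone hzΩ, one_pow, sub_self] at hlim
    have hsq : Tendsto (fun k => n * defect (F k z) ^ 2) atTop (𝓝 0) := by
      simpa using (hdefect.pow 2).const_mul (n : ℝ)
    refine tendsto_zero_iff_norm_tendsto_zero.2 (squeeze_zero (fun _ => norm_nonneg _)
      (fun k => Real.le_sqrt_of_sq_le
        (norm_eulerError_sq_le ((h.isSubsolution k).mem_relaxedSet z) i)) ?_)
    simpa using hsq.sqrt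
  · simp only [eq_zero_of_notMem (F _) hzΩ, eulerError_zero, tendsto_const_nhds]

theorem norm_velocity_le_one (h : IsConvexIntegrationLimit F v) (hn : n ≠ 0) (k : ℕ)
    (z : SpaceTime n) : ‖velocity (F k) z‖ ≤ 1 :=
  ((h.isSubsolution k).norm_velocity_lt_one hn z).le

theorem isWeaklyDivFree_massFlux (h : IsConvexIntegrationLimit F v) (hn : n ≠ 0) :
    IsWeaklyDivFree fun z => (v z, 0) := by
  refine isWeaklyDivFree_of_tendsto (X := fun k => TestFunction.postcompCLM massFlux (F k)) (C := 1)
    (fun k => (mem_linearSolutions.1 (h.isSubsolution k).mem_linearSolutions).1)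
    (fun k z => ?_) (h.tendsto_velocity.mono fun z hz => hz.prodMk_nhds tendsto_const_nhds)
  exact max_le (h.norm_velocity_le_one hn k z) (norm_zero.trans_le zero_le_one)

theorem isWeaklyDivFree_eulerFlux (h : IsConvexIntegrationLimit F v)
    (hΩ : Bornology.IsBounded (Ω : Set (SpaceTime n))) (i : Fin n) :
    IsWeaklyDivFree fun z => eulerFlux i (v z) (pressure (v z)) := by
  refine isWeaklyDivFree_of_tendsto
    (X := fun k => TestFunction.postcompCLM (momentumFlux i) (F k))
    (fun k => (mem_linearSolutions.1 (h.isSubsolution k).mem_linearSolutions).2 i)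
    (fun k z => norm_momentumFlux_le ((h.isSubsolution k).mem_relaxedSet z) i) ?_
  filter_upwards [h.tendsto_velocity, h.ae_tendsto_eulerError hΩ i] with z hz herror
  have hcont : Continuous fun w : Space n => eulerFlux i w (pressure w) := by
    have := (contDiff_pressure (n := n)).continuous
    unfold eulerFlux
    fun_prop
  have hlim := ((hcont.tendsto _).comp hz).sub
    (herror.prodMk_nhds (tendsto_const_nhds (x := (0 : ℝ))))
  rw [Prod.mk_zero_zero, sub_zero] at hlim
  exact hlim.congr fun k => (momentumFlux_eq_sub i (F k z)).symm

theorem memLp_top_pressure (h : IsConvexIntegrationLimit F v) (hn : n ≠ 0) :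
    MemLp (fun z => pressure (v z)) ⊤ volume :=
  memLp_top_of_bound
    (contDiff_pressure.continuous.comp_aestronglyMeasurable (h.memLp_top hn).aestronglyMeasurable)
    1 ((h.ae_norm_le_one hn).mono fun _ hz => abs_pressure_le_one hz)

theorem isWeakSolution (h : IsConvexIntegrationLimit F v) (hn : n ≠ 0)
    (hΩ : Bornology.IsBounded (Ω : Set (SpaceTime n))) :
    IsWeakSolution v (fun z => pressure (v z)) fun _ => 0 :=
  isWeakSolution_of_isWeaklyDivFree (h.memLp_top hn) (h.memLp_top_pressure hn)
    (h.isWeaklyDivFree_massFlux hn) (h.isWeaklyDivFree_eulerFlux hΩ)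

theorem norm_pressureField_le_one (h : IsConvexIntegrationLimit F v) (hn : n ≠ 0) (k : ℕ)
    (z : SpaceTime n) : ‖pressureField (F k) z‖ ≤ 1 :=
  abs_pressure_le_one (h.norm_velocity_le_one hn k z)

theorem eLpNorm_velocity_add_eLpNorm_pressureField_le (h : IsConvexIntegrationLimit F v)
    (hn : n ≠ 0) (k : ℕ) :
    eLpNorm (velocity (F k)) ⊤ volume + eLpNorm (pressureField (F k)) ⊤ volume ≤ 2 := by
  have hv := eLpNormEssSup_le_of_ae_bound (.of_forall (h.norm_velocity_le_one hn k))
    (μ := (volume : Measure (SpaceTime n)))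
  have hp := eLpNormEssSup_le_of_ae_bound (.of_forall (h.norm_pressureField_le_one hn k))
    (μ := (volume : Measure (SpaceTime n)))
  rw [ENNReal.ofReal_one] at hv hp
  exact (add_le_add hv hp).trans_eq one_add_one_eq_two

theorem tendsto_eLpNorm_velocity_sub (h : IsConvexIntegrationLimit F v) (hn : n ≠ 0)
    (hΩ : Bornology.IsBounded (Ω : Set (SpaceTime n))) {q : ℝ≥0∞} (hq : q ≠ ⊤) :
    Tendsto (fun k => eLpNorm (fun z => velocity (F k) z - v z) q volume) atTop (𝓝 0) :=
  tendsto_eLpNorm_sub_zero hΩ.measure_lt_top.ne (h.norm_velocity_le_one hn) h.tendsto_velocity hq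

theorem tendsto_eLpNorm_pressureField_sub (h : IsConvexIntegrationLimit F v) (hn : n ≠ 0)
    (hΩ : Bornology.IsBounded (Ω : Set (SpaceTime n))) {q : ℝ≥0∞} (hq : q ≠ ⊤) :
    Tendsto (fun k => eLpNorm (fun z => pressureField (F k) z - pressure (v z)) q volume) atTop
      (𝓝 0) :=
  tendsto_eLpNorm_sub_zero hΩ.measure_lt_top.ne (h.norm_pressureField_le_one hn)
    (h.tendsto_velocity.mono fun _ hz => (contDiff_pressure.continuous.tendsto _).comp hz) hq

end IsConvexIntegrationLimit

end EulerLimit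

end Euler

end

open Euler in
theorem theorem4p1 (n : ℕ) (hn : 2 ≤ n) (Ω : TopologicalSpace.Opens (Euler.SpaceTime n))
    (hΩ : Bornology.IsBounded (Ω : Set (Euler.SpaceTime n))) :
    ∃ (v : Euler.SpaceTime n → Euler.Space n) (p : Euler.SpaceTime n → ℝ),
      MemLp v ∞ volume ∧ MemLp p ∞ volume ∧
      Euler.IsWeakSolution v p (fun _ => 0) ∧
      (∀ᵐ z ∂(volume : Measure (Euler.SpaceTime n)), z ∈ Ω → ‖v z‖ = 1) ∧
      (∀ᵐ z ∂(volume : Measure (Euler.SpaceTime n)), z ∉ Ω → v z = 0 ∧ p z = 0) ∧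
      ∃ (vk : ℕ → 𝓓(Ω, Euler.Space n)) (pk : ℕ → 𝓓(Ω, ℝ)) (fk : ℕ → 𝓓(Ω, Euler.Space n)),
        (∀ k, Euler.IsClassicalSolution (vk k) (pk k) (fk k)) ∧
        Tendsto (fun k => Euler.hNegOneNorm (fk k)) atTop (𝓝 0) ∧
        (∃ C : ℝ≥0, ∀ k, eLpNorm (vk k) ∞ volume + eLpNorm (pk k) ∞ volume ≤ C) ∧
        (∀ q : ℝ≥0∞, q < ∞ →
          Tendsto (fun k => eLpNorm (fun z => vk k z - v z) q volume) atTop (𝓝 0) ∧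
          Tendsto (fun k => eLpNorm (fun z => pk k z - p z) q volume) atTop (𝓝 0)) := by
  have hn0 : n ≠ 0 := by omega
  obtain ⟨F, v, h⟩ := exists_isConvexIntegrationLimit hn hΩ
  refine ⟨v, fun z => pressure (v z), h.memLp_top hn0, h.memLp_top_pressure hn0,
    h.isWeakSolution hn0 hΩ, h.ae_norm_eq_one hΩ, ?_,
    fun k => velocity (F k), fun k => pressureField (F k), fun k => force (F k),
    fun k => isClassicalSolution_of_mem_linearSolutions (h.isSubsolution k).mem_linearSolutions,
    h.tendsto_hNegOneNorm_force hΩ, ⟨2, h.eLpNorm_velocity_add_eLpNorm_pressureField_le hn0⟩,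
    fun q hq => ⟨h.tendsto_eLpNorm_velocity_sub hn0 hΩ hq.ne,
      h.tendsto_eLpNorm_pressureField_sub hn0 hΩ hq.ne⟩⟩
  exact h.ae_eq_zero_of_notMem.mono fun z hz hzΩ =>
    ⟨hz hzΩ, (congrArg pressure (hz hzΩ)).trans pressure_zero⟩
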